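/- For an irrational number $\alpha$ let $\mu(\alpha)=\bigl(\liminf_{p\in\mathbb Z,\,q\in\mathbb N}|q(q\alpha-p)|\bigr)^{-1}\in(0,\infty]$, where $\mathbb N=\{1,2,\ldots\}$. The Lagrange spectrum $\mathbb L\subset\mathbb R$ is the set of all finite values $\mu(\alpha)$, $\alpha$ irrational. An irrational number $\alpha$ with $\mu(\alpha)<\infty$ is called attainable if $\bigl|\alpha-\frac pq\bigr|\le\frac1{\mu(\alpha)q^2}$ has infinitely many solutions in integers $p$ and $q\ge 1$. A number $\lambda\in\mathbb L$ is called admissible if there is an attainable irrational $\alpha$ with $\mu(\alpha)=\lambda$. A maximal gap of $\mathbb L$ is a nonempty open interval $(a,b)$ with $a,b\in\mathbb L$ and $(a,b)\cap\mathbb L=\emptyset$; $a$ is its left endpoint. For a doubly infinite sequence $B=(b_i)_{i\in\mathbb Z}$ of positive integers put $\lambda_i(B)=[b_i;b_{i-1},b_{i-2},\ldots]+[0;b_{i+1},b_{i+2},\ldots]$ and $M(B)=\sup_{i\in\mathbb Z}\lambda_i(B)$. The sequence $B$ is called purely periodic if there is an integer $n\ge1$ with $b_{i+n}=b_i$ for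 all $i\in\mathbb Z$. Let $a$ be the left endpoint of a maximal gap $(a,b)$ of the Lagrange spectrum. Then $a$ is not admissible if and only if there is no purely periodic doubly infinite sequence $B$ of positive integers with $\lambda_0(B)=M(B)=a$. -/

import Mathlib

open Filter Topology
open scoped ENNReal

noncomputable section

/-! ### Lagrange constants, the Lagrange spectrum, attainable and admissible numbers -/

/-- The Lagrange constant `μ(α) = (liminf |q (q α - p)|)⁻¹`, where the lower limit is over all
pairs `(p, q)` with `p ∈ ℤ` and `q ∈ {1, 2, …}` (outside finite sets of pairs). It is an extended
real number: the inverse is taken in `[0, ∞]`, so that `μ(α) = ∞` when the lower limit is `0`. -/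
def lagrangeConst (α : ℝ) : EReal :=
  (((liminf (fun x : ℤ × ℕ+ =>
      ENNReal.ofReal |((x.2 : ℕ) : ℝ) * (((x.2 : ℕ) : ℝ) * α - (x.1 : ℝ))|) cofinite)⁻¹ : ℝ≥0∞) :
    EReal)

/-- The Lagrange spectrum: the set of all finite Lagrange constants of irrational numbers. -/
def lagrangeSpectrum : Set ℝ :=
  {x | ∃ α : ℝ, Irrational α ∧ lagrangeConst α = (x : EReal)}

/-- A number `α` with finite Lagrange constant `μ(α)` is attainable if
`|α - p / q| ≤ 1 / (μ(α) q²)` has infinitely many solutions in integers `p` and `q ≥ 1`. -/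
def IsAttainable (α : ℝ) : Prop :=
  {x : ℤ × ℕ+ | |α - (x.1 : ℝ) / ((x.2 : ℕ) : ℝ)| ≤
    1 / ((lagrangeConst α).toReal * ((x.2 : ℕ) : ℝ) ^ 2)}.Infinite

/-- An element of the Lagrange spectrum is admissible if it is the Lagrange constant of some
attainable irrational number. -/
def IsAdmissible (x : ℝ) : Prop :=
  x ∈ lagrangeSpectrum ∧
    ∃ α : ℝ, Irrational α ∧ IsAttainable α ∧ lagrangeConst α = (x : EReal)

/-- `(a, b)` is a maximal gap of the Lagrange spectrum: a nonempty open interval that contains no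
point of the spectrum and whose endpoints both lie in the spectrum. -/
def IsMaximalGap (a b : ℝ) : Prop :=
  a < b ∧ a ∈ lagrangeSpectrum ∧ b ∈ lagrangeSpectrum ∧ Set.Ioo a b ∩ lagrangeSpectrum = ∅

/-! ### Infinite continued fractions -/

/-- The infinite continued fraction `[h; a 0, a 1, a 2, …]`, as a formal object. -/
def infContFract (h : ℕ) (a : ℕ → ℕ+) : GenContFract ℝ where
  h := (h : ℝ)
  s := Stream'.Seq.ofStream fun n => ⟨1, ((a n : ℕ) : ℝ)⟩

/-- The value of `[h; a 0, a 1, a 2, …]`: the limit of its convergents. The limit always exists,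
see `tendsto_cfValue`. -/
def cfValue (h : ℕ) (a : ℕ → ℕ+) : ℝ :=
  limUnder atTop fun n : ℕ => (infContFract h a).convs n

theorem infContFract_get (h : ℕ) (a : ℕ → ℕ+) (n : ℕ) :
    (infContFract h a).s.get? n = some ⟨1, ((a n : ℕ) : ℝ)⟩ := rfl

theorem infContFract_dens (h : ℕ) (a : ℕ → ℕ+) (n : ℕ) :
    1 ≤ (infContFract h a).dens n ∧
      (infContFract h a).dens n ≤ (infContFract h a).dens (n + 1) ∧
      (2 : ℝ) ^ n ≤ (infContFract h a).dens n * (infContFract h a).dens (n + 1) := by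
  have ha : ∀ n, (1 : ℝ) ≤ ((a n : ℕ) : ℝ) := fun n => by exact_mod_cast (a n).pos
  induction n with
  | zero =>
    have h0 : (infContFract h a).dens 0 = 1 := GenContFract.zeroth_den_eq_one
    have h1 : (infContFract h a).dens 1 = ((a 0 : ℕ) : ℝ) :=
      GenContFract.first_den_eq (infContFract_get h a 0)
    simp only [zero_add, h0, h1]
    refine ⟨le_rfl, ha 0, ?_⟩
    simpa using ha 0
  | succ n ih =>
    obtain ⟨i0, i1, i2⟩ := ih
    have hr := GenContFract.dens_recurrence (infContFract_get h a (n + 1)) rfl rfl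
    have h2 : (infContFract h a).dens n + (infContFract h a).dens (n + 1) ≤
        (infContFract h a).dens (n + 2) := by
      rw [hr]
      have := ha (n + 1)
      nlinarith
    refine ⟨by linarith, by linarith, ?_⟩
    show (2 : ℝ) ^ (n + 1) ≤ (infContFract h a).dens (n + 1) * (infContFract h a).dens (n + 2)
    rw [pow_succ]
    nlinarith

/-- The convergents of an infinite continued fraction converge to its value. -/
theorem tendsto_cfValue (h : ℕ) (a : ℕ → ℕ+) :
    Tendsto (fun n : ℕ => (infContFract h a).convs n) atTop (𝓝 (cfValue h a)) := by
  apply CauchySeq.tendsto_limUnder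
  refine cauchySeq_of_le_geometric (1 / 2) 1 (by norm_num) fun n => ?_
  obtain ⟨i0, i1, i2⟩ := infContFract_dens h a n
  have hs : (infContFract h a).IsSimpContFract := by
    intro m x hx
    have : some (1 : ℝ) = some x := hx
    exact (Option.some.inj this).symm
  have hdet := SimpContFract.determinant (s := ⟨infContFract h a, hs⟩) (n := n)
    (fun ht => by
      have : some (⟨1, ((a n : ℕ) : ℝ)⟩ : GenContFract.Pair ℝ) = none := ht
      cases this)
  simp only at hdet
  have p0 : 0 < (infContFract h a).dens n := by linarith
  have p1 : 0 < (infContFract h a).dens (n + 1) := by linarith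
  rw [Real.dist_eq, GenContFract.conv_eq_num_div_den, GenContFract.conv_eq_num_div_den,
    div_sub_div _ _ p0.ne' p1.ne', hdet, abs_div, abs_pow, abs_neg, abs_one, one_pow, one_mul,
    abs_of_pos (mul_pos p0 p1), one_div_pow]
  exact one_div_le_one_div_of_le (by positivity) i2

/-! ### Doubly infinite sequences of positive integers -/

/-- `λ_i(B) = [b_i; b_{i-1}, b_{i-2}, …] + [0; b_{i+1}, b_{i+2}, …]` for a doubly infinite
sequence `B = (…, b_{-1}, b_0, b_1, …)` of positive integers. -/
def biLambda (B : ℤ → ℕ+) (i : ℤ) : ℝ :=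
  cfValue (B i : ℕ) (fun n => B (i - 1 - n)) + cfValue 0 (fun n => B (i + 1 + n))

/-- `M(B)`, the supremum of all `λ_i(B)`, in the extended real numbers. -/
def markoffM (B : ℤ → ℕ+) : EReal :=
  ⨆ i : ℤ, (biLambda B i : EReal)

/-- `B` is the repetition, in both directions, of a finite nonempty sequence. -/
def IsPurelyPeriodic (B : ℤ → ℕ+) : Prop :=
  ∃ n : ℕ, 0 < n ∧ Function.Periodic B (n : ℤ)

end

/-! ### Values of infinite continued fractions -/

/-! Write `α = c + 1/[d 0; d 1, …]`. By Perron's formula (`convErr_mul`), `1/(q|qα - p|)` at the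
`n`-th convergent equals `λ_n = oneLambda d n`, the finite past of `d` at `n` plus its infinite
future. By Legendre's theorem only multiples of convergents matter, so `μ(α) = limsup λ_n`
(`lagrangeConst_eq_limsup`), and `α` is attainable iff `λ_n ≥ μ(α)` infinitely often
(`isAttainable_iff`).

If a periodic `B` attains `a` at `0`, read its digits from index `1`. At infinitely many positions
the future is that of `B` at `0`, and the past is truncated on the side that increases it; so `λ_n ≥
a` there (`isAdmissible_of_periodic`).

Conversely let `λ_n ≥ a` infinitely often. The two-sided sequences whose long windows all occur in a
far tail of `d` form a subshift `Ω`. Windows are taken so long that all `λ_i` on `Ω` stay below `b`.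
A periodic member attains its maximum, which lies in the spectrum, hence is at most `a` by the gap;
periodic members are dense, so `λ_i ≤ a` on all of `Ω`. Infinitely many positions `n` with `λ_n ≥ a`
share a central window; by compactness some `B ∈ Ω` with that window has the largest past. Gluing
this past to the future of `d` at `n` stays in `Ω`, so comparing `≤ a` with `a ≤ λ_n` shows that the
finite past of `d` at `n` is at least the past of `B`. Two such positions `n < n + L` force the past
of `B` to have period `L` and to spell the digits of `d` between them (`past_periodic_of_isMax`).
Hence `d` is eventually periodic, and its periodic continuation attains `a`. -/

theorem infContFract_convs_succ (h : ℕ) (a : ℕ → ℕ+) (n : ℕ) :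
    (infContFract h a).convs (n + 1) =
      h + ((infContFract (a 0) fun k => a (k + 1)).convs n)⁻¹ := by
  -- Positivity of the digits identifies the three-term recurrence with direct evaluation, which
  -- unfolds from the front.
  have key : ∀ (h : ℕ) (a : ℕ → ℕ+) (n : ℕ),
      (infContFract h a).convs n = (infContFract h a).convs' n := by
    intro h a n
    refine GenContFract.convs_eq_convs' fun {gp m} _ hm => ?_
    rw [infContFract_get] at hm
    obtain rfl := Option.some.inj hm
    exact ⟨one_pos, Nat.cast_pos.2 (a m).pos⟩
  rw [key, key, GenContFract.convs', GenContFract.convs',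
    GenContFract.convs'Aux_succ_some (p := ⟨1, ((a 0 : ℕ) : ℝ)⟩) rfl, one_div]
  rfl

theorem le_infContFract_convs (h : ℕ) (a : ℕ → ℕ+) (n : ℕ) :
    (h : ℝ) ≤ (infContFract h a).convs n := by
  induction n generalizing h a with
  | zero => exact (GenContFract.zeroth_conv_eq_h (g := infContFract h a)).ge
  | succ n ih =>
    rw [infContFract_convs_succ]
    have := ih (a 0) fun k => a (k + 1)
    have h0 : (0 : ℝ) ≤ ((a 0 : ℕ) : ℝ) := Nat.cast_nonneg _
    have : 0 ≤ ((infContFract (a 0) fun k => a (k + 1)).convs n)⁻¹ :=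
      inv_nonneg.2 (h0.trans this)
    linarith

/-- The value of `[d 0; d 1, d 2, …]`. -/
noncomputable def cfFull (d : ℕ → ℕ+) : ℝ := cfValue (d 0) fun n => d (n + 1)

theorem one_le_coe (n : ℕ+) : (1 : ℝ) ≤ ((n : ℕ) : ℝ) := by exact_mod_cast n.pos

theorem coe_le_cfFull (d : ℕ → ℕ+) : ((d 0 : ℕ) : ℝ) ≤ cfFull d :=
  ge_of_tendsto' (tendsto_cfValue _ _) fun n => le_infContFract_convs _ _ n

theorem one_le_cfFull (d : ℕ → ℕ+) : 1 ≤ cfFull d := (one_le_coe _).trans (coe_le_cfFull d)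

theorem cfFull_pos (d : ℕ → ℕ+) : 0 < cfFull d := one_pos.trans_le (one_le_cfFull d)

theorem cfValue_eq (h : ℕ) (a : ℕ → ℕ+) : cfValue h a = h + (cfFull a)⁻¹ := by
  refine tendsto_nhds_unique ((tendsto_add_atTop_iff_nat 1).2 (tendsto_cfValue h a)) ?_
  simp only [infContFract_convs_succ]
  exact ((tendsto_cfValue _ _).inv₀ (cfFull_pos a).ne').const_add _

theorem cfFull_eq (d : ℕ → ℕ+) : cfFull d = (d 0 : ℕ) + (cfFull fun n => d (n + 1))⁻¹ :=
  cfValue_eq _ _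

theorem cfFull_tail_eq (d : ℕ → ℕ+) (k : ℕ) : (cfFull fun i => d (k + i)) =
    (d k : ℕ) + (cfFull fun i => d (k + 1 + i))⁻¹ := by
  rw [cfFull_eq]
  simp only [add_zero, add_assoc, add_comm 1]

theorem one_lt_cfFull (d : ℕ → ℕ+) : 1 < cfFull d := by
  rw [cfFull_eq]
  have := inv_pos.2 (cfFull_pos fun n => d (n + 1))
  linarith [one_le_coe (d 0)]

/-- Infinite descent on the denominator: if `q` clears the denominator of `d 0 + 1/v`, then the
positive integer `q/v < q` clears that of the tail `v`. -/
theorem irrational_cfFull (d : ℕ → ℕ+) : Irrational (cfFull d) := by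
  suffices H : ∀ (q : ℕ) (p : ℤ) (d : ℕ → ℕ+), cfFull d * q = p → q = 0 by
    rintro ⟨r, hr⟩
    refine r.den_nz (H r.den r.num d ?_)
    rw [← hr]
    exact_mod_cast Rat.mul_den_eq_num r
  intro q
  induction q using Nat.strong_induction_on with
  | _ q ih =>
    intro p d h
    by_contra hq
    have hq0 : (0 : ℝ) < q := by positivity
    set v := cfFull fun n => d (n + 1) with hv
    have hv1 : 1 < v := one_lt_cfFull _
    have hd : v⁻¹ * q = ((p - (d 0 : ℕ) * q : ℤ) : ℝ) := by
      push_cast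
      rw [← h, cfFull_eq d, ← hv]
      ring
    have hpos : 0 < v⁻¹ * q := by positivity
    have hlt : v⁻¹ * q < q := by
      have := inv_lt_one_of_one_lt₀ hv1
      nlinarith
    obtain ⟨r, hr⟩ := Int.eq_ofNat_of_zero_le
      (show 0 ≤ p - (d 0 : ℕ) * q by rw [hd] at hpos; exact_mod_cast hpos.le)
    rw [hr] at hd
    push_cast at hd
    have hrq : r < q := by rw [hd] at hlt; exact_mod_cast hlt
    have := ih r hrq q (fun n => d (n + 1)) (by
      rw [← hv, ← hd]; field_simp; simp)
    rw [this] at hd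
    rw [hd] at hpos
    simp at hpos

/-- The finite continued fraction `[e 0; e 1, …, e (n - 1), z]`. -/
noncomputable def cfFin (e : ℕ → ℕ+) : ℕ → ℝ → ℝ
  | 0, z => z
  | n + 1, z => (e 0 : ℕ) + (cfFin (fun k => e (k + 1)) n z)⁻¹

theorem cfFin_pos (e : ℕ → ℕ+) (n : ℕ) {z : ℝ} (hz : 0 < z) : 0 < cfFin e n z := by
  induction n generalizing e with
  | zero => exact hz
  | succ n ih =>
    have := inv_pos.2 (ih fun k => e (k + 1))
    have := one_le_coe (e 0)
    simp only [cfFin]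
    linarith

theorem one_lt_cfFin (e : ℕ → ℕ+) (n : ℕ) {z : ℝ} (hz : 1 < z) : 1 < cfFin e n z := by
  cases n with
  | zero => exact hz
  | succ n =>
    have := inv_pos.2 (cfFin_pos (fun k => e (k + 1)) n (one_pos.trans hz))
    have := one_le_coe (e 0)
    simp only [cfFin]
    linarith

theorem cfFin_congr {e e' : ℕ → ℕ+} {n : ℕ} (h : ∀ k < n, e k = e' k) (z : ℝ) :
    cfFin e n z = cfFin e' n z := by
  induction n generalizing e e' with
  | zero => rfl
  | succ n ih =>
    simp only [cfFin]
    rw [h 0 (by omega), ih fun k hk => h (k + 1) (by omega)]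

theorem cfFull_eq_cfFin (d : ℕ → ℕ+) (n : ℕ) :
    cfFull d = cfFin d n (cfFull fun k => d (n + k)) := by
  induction n generalizing d with
  | zero => simp [cfFin]
  | succ n ih =>
    rw [cfFull_eq, cfFin, ih fun k => d (k + 1)]
    simp only [show ∀ k, n + k + 1 = n + 1 + k by intro k; omega]

/-- Backward extension: a recursion `x (k + 1) = c k + 1 / x k` unfolds to a continued fraction. -/
theorem eq_cfFin_of_rec {x : ℕ → ℝ} {c : ℕ → ℕ+} (h : ∀ k, x (k + 1) = (c k : ℕ) + (x k)⁻¹)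
    (m n : ℕ) : x (m + n) = cfFin (fun k => c (m + n - 1 - k)) n (x m) := by
  induction n with
  | zero => rfl
  | succ n ih =>
    rw [← add_assoc, h, cfFin, ih]
    congr 2
    exact cfFin_congr (fun k hk => by congr 1; omega) _

theorem continuousOn_cfFin (e : ℕ → ℕ+) (n : ℕ) : ContinuousOn (cfFin e n) (Set.Ioi 0) := by
  induction n generalizing e with
  | zero => exact continuousOn_id
  | succ n ih =>
    exact continuousOn_const.add ((ih _).inv₀ fun z hz => (cfFin_pos _ n hz).ne')

/-- Cylinders of continued fractions are intervals. -/
theorem exists_cfFin_eq (e : ℕ → ℕ+) (n : ℕ) {s t z : ℝ} (hs : 0 < s) (ht : 0 < t)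
    (hz : z ∈ Set.uIcc (cfFin e n s) (cfFin e n t)) :
    ∃ r ∈ Set.uIcc s t, cfFin e n r = z := by
  refine intermediate_value_uIcc ((continuousOn_cfFin e n).mono fun r hr => ?_) hz
  exact lt_of_lt_of_le (lt_min hs ht) hr.1

/-! ### Uniqueness of digits and contraction estimates -/

theorem eq_and_eq_of_add_inv_eq {m n : ℕ} {x y : ℝ} (hx : 1 < x) (hy : 1 < y)
    (h : (m : ℝ) + x⁻¹ = n + y⁻¹) : m = n ∧ x = y := by
  have hx0 := inv_pos.2 (one_pos.trans hx)
  have hy0 := inv_pos.2 (one_pos.trans hy)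
  have hx1 := inv_lt_one_of_one_lt₀ hx
  have hy1 := inv_lt_one_of_one_lt₀ hy
  have hmn : m = n := by
    have h1 : (m : ℝ) < n + 1 := by linarith
    have h2 : (n : ℝ) < m + 1 := by linarith
    have h1' : m < n + 1 := by exact_mod_cast h1
    have h2' : n < m + 1 := by exact_mod_cast h2
    omega
  subst hmn
  exact ⟨rfl, inv_injective (by linarith)⟩

/-- Since `z > 1`, every complete quotient exceeds `1`, so each digit is an integer part. The tail
`z` is an arbitrary real, so that points produced by the intermediate value theorem can be inserted.
-/
theorem digits_of_cfFull_eq_cfFin {d e : ℕ → ℕ+} {n : ℕ} {z : ℝ} (hz : 1 < z)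
    (h : cfFull d = cfFin e n z) :
    (∀ k < n, d k = e k) ∧ (cfFull fun k => d (n + k)) = z := by
  induction n generalizing d e with
  | zero => exact ⟨fun k hk => absurd hk (by omega), by simpa [cfFin] using h⟩
  | succ n ih =>
    rw [cfFull_eq, cfFin] at h
    obtain ⟨h0, h1⟩ := eq_and_eq_of_add_inv_eq (one_lt_cfFull _) (one_lt_cfFin _ n hz) h
    obtain ⟨h2, h3⟩ := ih h1
    refine ⟨fun k hk => ?_, ?_⟩
    · cases k with
      | zero => exact PNat.coe_injective h0
      | succ k => exact h2 k (by omega)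
    · rw [← h3]
      congr 1
      funext k
      congr 1
      omega

theorem cfFull_injective : Function.Injective cfFull := by
  intro d e h
  funext k
  exact (digits_of_cfFull_eq_cfFin (one_lt_cfFull _) (h.trans (cfFull_eq_cfFin e (k + 1)))).1 k
    (by omega)

/-- Two continued fractions with the same first `2 m + 1` partial quotients are close. -/
theorem abs_sub_le_of_rec (m : ℕ) {x y : ℕ → ℝ} {e : ℕ → ℕ+}
    (hx : ∀ k < 2 * m, x k = (e k : ℕ) + (x (k + 1))⁻¹)
    (hy : ∀ k < 2 * m, y k = (e k : ℕ) + (y (k + 1))⁻¹)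
    (hx1 : ∀ k ≤ 2 * m, 1 ≤ x k) (hy1 : ∀ k ≤ 2 * m, 1 ≤ y k)
    (hxy : |x (2 * m) - y (2 * m)| ≤ 1) : |x 0 - y 0| ≤ (1 / 4) ^ m := by
  induction m generalizing x y e with
  | zero => simpa using hxy
  | succ m ih =>
    have h2 := ih (x := fun k => x (k + 2)) (y := fun k => y (k + 2)) (e := fun k => e (k + 2))
      (fun k hk => hx (k + 2) (by omega)) (fun k hk => hy (k + 2) (by omega))
      (fun k hk => hx1 (k + 2) (by omega)) (fun k hk => hy1 (k + 2) (by omega)) hxy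
    simp only [zero_add] at h2
    have x1 := hx1 1 (by omega)
    have x2 := hx1 2 (by omega)
    have y1 := hy1 1 (by omega)
    have y2 := hy1 2 (by omega)
    -- `u v = e v + 1 ≥ 2`. Two digits divide the difference by a product of two such factors, hence
    -- by at least `4`; a single digit need not contract at all.
    have prod : ∀ {e : ℕ+} {u v : ℝ}, 1 ≤ v → u = (e : ℕ) + v⁻¹ → 2 ≤ u * v := by
      intro e u v hv hu
      have := one_le_coe e
      rw [hu, add_mul, inv_mul_cancel₀ (by linarith)]
      nlinarith
    have px := prod x2 (hx 1 (by omega))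
    have py := prod y2 (hy 1 (by omega))
    have e1 : x 0 - y 0 = (x 2 - y 2) / ((x 1 * x 2) * (y 1 * y 2)) := by
      have : x 1 - y 1 = (y 2 - x 2) / (x 2 * y 2) := by
        rw [hx 1 (by omega), hy 1 (by omega)]
        field_simp
        ring
      have h' : x 0 - y 0 = (y 1 - x 1) / (x 1 * y 1) := by
        rw [hx 0 (by omega), hy 0 (by omega)]
        field_simp
        ring
      rw [h', show y 1 - x 1 = (x 2 - y 2) / (x 2 * y 2) by
        rw [← neg_sub, this]; ring, div_div]
      congr 1
      ring
    rw [e1, abs_div, pow_succ, abs_of_pos (show 0 < (x 1 * x 2) * (y 1 * y 2) by positivity),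
      div_le_iff₀ (by positivity)]
    have : 4 ≤ (x 1 * x 2) * (y 1 * y 2) := by nlinarith
    calc _ ≤ (1 / 4 : ℝ) ^ m := h2
      _ = (1 / 4) ^ m * (1 / 4) * 4 := by ring
      _ ≤ _ := by gcongr

theorem abs_sub_le_one_of_rec {e : ℕ+} {x y x' y' : ℝ} (hx : x = (e : ℕ) + x'⁻¹)
    (hy : y = (e : ℕ) + y'⁻¹) (hx' : 1 ≤ x') (hy' : 1 ≤ y') : |x - y| ≤ 1 := by
  have := inv_pos.2 (one_pos.trans_le hx')
  have := inv_pos.2 (one_pos.trans_le hy')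
  have := inv_le_one_of_one_le₀ hx'
  have := inv_le_one_of_one_le₀ hy'
  rw [hx, hy, abs_le]
  constructor <;> linarith

theorem abs_cfFull_sub_le {d d' : ℕ → ℕ+} {m : ℕ} (h : ∀ k ≤ 2 * m, d k = d' k) :
    |cfFull d - cfFull d'| ≤ (1 / 4) ^ m := by
  have := abs_sub_le_of_rec m (x := fun k => cfFull fun i => d (k + i))
    (y := fun k => cfFull fun i => d' (k + i)) (e := d) (fun k _ => cfFull_tail_eq d k)
    (fun k hk => by rw [h k (by omega)]; exact cfFull_tail_eq d' k) (fun k _ => one_le_cfFull _)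
    (fun k _ => one_le_cfFull _)
    (abs_sub_le_one_of_rec (cfFull_tail_eq d _) (by rw [h _ le_rfl]; exact cfFull_tail_eq d' _) (one_le_cfFull _)
      (one_le_cfFull _))
  simpa using this

theorem abs_inv_cfFull_sub_le {d d' : ℕ → ℕ+} {m : ℕ} (h : ∀ k ≤ 2 * m, d k = d' k) :
    |(cfFull d)⁻¹ - (cfFull d')⁻¹| ≤ (1 / 4) ^ m := by
  have h1 := one_le_cfFull d
  have h2 := one_le_cfFull d'
  rw [inv_sub_inv (by positivity) (by positivity), abs_div,
    abs_of_pos (show 0 < cfFull d * cfFull d' by positivity), abs_sub_comm]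
  exact (div_le_self (abs_nonneg _) (by nlinarith)).trans (abs_cfFull_sub_le h)

/-! ### The two-sided quantities attached to a one-sided sequence -/

/-- The finite continued fraction `[d n; d (n - 1), …, d 0]`. -/
noncomputable def cfBack (d : ℕ → ℕ+) : ℕ → ℝ
  | 0 => (d 0 : ℕ)
  | n + 1 => (d (n + 1) : ℕ) + (cfBack d n)⁻¹

/-- `[d n; d (n - 1), …, d 0] + [0; d (n + 1), d (n + 2), …]`. -/
noncomputable def oneLambda (d : ℕ → ℕ+) (n : ℕ) : ℝ :=
  cfBack d n + (cfFull fun k => d (n + 1 + k))⁻¹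

theorem one_le_cfBack (d : ℕ → ℕ+) (n : ℕ) : 1 ≤ cfBack d n := by
  induction n with
  | zero => exact one_le_coe _
  | succ n ih =>
    have := inv_pos.2 (one_pos.trans_le ih)
    have := one_le_coe (d (n + 1))
    simp only [cfBack]
    linarith

theorem one_lt_cfBack_succ (d : ℕ → ℕ+) (n : ℕ) : 1 < cfBack d (n + 1) := by
  have := inv_pos.2 (one_pos.trans_le (one_le_cfBack d n))
  have := one_le_coe (d (n + 1))
  simp only [cfBack]
  linarith

theorem coe_le_cfBack (d : ℕ → ℕ+) (n : ℕ) : ((d n : ℕ) : ℝ) ≤ cfBack d n := by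
  cases n with
  | zero => exact le_rfl
  | succ n =>
    have := inv_pos.2 (one_pos.trans_le (one_le_cfBack d n))
    simp only [cfBack]
    linarith

theorem cfBack_le (d : ℕ → ℕ+) (n : ℕ) : cfBack d n ≤ (d n : ℕ) + 1 := by
  cases n with
  | zero => simp [cfBack]
  | succ n =>
    have := inv_le_one_of_one_le₀ (one_le_cfBack d n)
    simp only [cfBack]
    linarith

theorem cfBack_add (d : ℕ → ℕ+) (m n : ℕ) :
    cfBack d (m + n) = cfFin (fun k => d (m + n - k)) n (cfBack d m) := by
  rw [eq_cfFin_of_rec (x := cfBack d) (c := fun k => d (k + 1)) (fun k => rfl) m n]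
  exact cfFin_congr (fun k hk => by congr 1; omega) _

theorem abs_cfBack_sub_le {d e : ℕ → ℕ+} {m n : ℕ} (hn : 2 * m < n)
    (h : ∀ k ≤ 2 * m, d (n - k) = e k) : |cfBack d n - cfFull e| ≤ (1 / 4) ^ m := by
  have hb : ∀ k ≤ 2 * m, cfBack d (n - k) = (e k : ℕ) + (cfBack d (n - (k + 1)))⁻¹ := by
    intro k hk
    rw [← h k hk, show n - k = n - (k + 1) + 1 by omega]
    rfl
  have := abs_sub_le_of_rec m (x := fun k => cfBack d (n - k))
    (y := fun k => cfFull fun i => e (k + i)) (e := e) (fun k hk => hb k hk.le)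
    (fun k hk => cfFull_tail_eq e k) (fun k _ => one_le_cfBack _ _) (fun k _ => one_le_cfFull _)
    (abs_sub_le_one_of_rec (hb _ le_rfl) (cfFull_tail_eq e _) (one_le_cfBack _ _) (one_le_cfFull _))
  simpa using this

theorem biLambda_eq (B : ℤ → ℕ+) (i : ℤ) :
    biLambda B i = cfFull (fun n : ℕ => B (i - n)) + (cfFull fun n : ℕ => B (i + 1 + n))⁻¹ := by
  have h : cfFull (fun n : ℕ => B (i - n)) = cfValue (B i) fun n => B (i - 1 - n) := by
    simp only [cfFull, Nat.cast_zero, sub_zero, Nat.cast_add, Nat.cast_one, sub_sub,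
      add_comm (1 : ℤ)]
  rw [biLambda, cfValue_eq 0, h, Nat.cast_zero, zero_add]

theorem abs_oneLambda_sub_biLambda_le {d : ℕ → ℕ+} {B : ℤ → ℕ+} {i : ℤ} {m n : ℕ}
    (hn : 2 * m < n) (h : ∀ k : ℤ, -(2 * m) ≤ k → k ≤ 2 * m + 1 → d (n + k).toNat = B (i + k)) :
    |oneLambda d n - biLambda B i| ≤ 2 * (1 / 4) ^ m := by
  rw [biLambda_eq, oneLambda, add_sub_add_comm]
  refine (abs_add_le _ _).trans ?_
  rw [two_mul]
  refine add_le_add (abs_cfBack_sub_le hn fun k hk => ?_) (abs_inv_cfFull_sub_le fun k hk => ?_)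
  · have := h (-k) (by omega) (by omega)
    rw [show ((n : ℤ) + -k).toNat = n - k by omega] at this
    rw [this]
    rfl
  · have := h (k + 1) (by omega) (by omega)
    rw [show ((n : ℤ) + (k + 1)).toNat = n + 1 + k by omega] at this
    rw [this]
    congr 1
    ring

theorem abs_biLambda_sub_biLambda_le {B C : ℤ → ℕ+} {i j : ℤ} {m : ℕ}
    (h : ∀ k : ℤ, -(2 * m) ≤ k → k ≤ 2 * m + 1 → B (i + k) = C (j + k)) :
    |biLambda B i - biLambda C j| ≤ 2 * (1 / 4) ^ m := by
  rw [biLambda_eq, biLambda_eq, add_sub_add_comm]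
  refine (abs_add_le _ _).trans ?_
  rw [two_mul]
  refine add_le_add (abs_cfFull_sub_le fun k hk => ?_) (abs_inv_cfFull_sub_le fun k hk => ?_)
  · exact h (-k) (by omega) (by omega)
  · have := h (k + 1) (by omega) (by omega)
    rwa [← add_assoc, ← add_assoc, add_right_comm, add_right_comm j] at this

/-! ### Convergents and the Lagrange constant -/

/-- Denominators of the convergents of `[c; d 0, d 1, …]`. -/
def convDen (d : ℕ → ℕ+) : ℕ → ℕ
  | 0 => 1
  | 1 => d 0
  | n + 2 => d (n + 1) * convDen d (n + 1) + convDen d n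

/-- Numerators of the convergents of `[c; d 0, d 1, …]`. -/
def convNum (c : ℤ) (d : ℕ → ℕ+) : ℕ → ℤ
  | 0 => c
  | 1 => (d 0 : ℕ) * c + 1
  | n + 2 => (d (n + 1) : ℕ) * convNum c d (n + 1) + convNum c d n

theorem convDen_pos (d : ℕ → ℕ+) (n : ℕ) : 0 < convDen d n := by
  induction n using Nat.twoStepInduction with
  | zero => exact one_pos
  | one => exact (d 0).pos
  | more n h0 h1 => exact Nat.add_pos_right _ h0

theorem le_convDen (d : ℕ → ℕ+) (n : ℕ) : n ≤ convDen d n := by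
  induction n using Nat.twoStepInduction with
  | zero => exact Nat.zero_le _
  | one => exact (d 0).pos
  | more n h0 h1 =>
    have := convDen_pos d n
    have := Nat.le_mul_of_pos_left (convDen d (n + 1)) (d (n + 1)).pos
    simp only [convDen]
    omega

/-- The mirror formula: the recurrence of the denominators, divided through, is the recurrence of
the reversed continued fraction. This is how the past enters `λ_n`. -/
theorem convDen_succ_eq (d : ℕ → ℕ+) (n : ℕ) :
    (convDen d (n + 1) : ℝ) = cfBack d n * convDen d n := by
  induction n with
  | zero => simp [convDen, cfBack]
  | succ n ih =>
    have h := one_le_cfBack d n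
    simp only [convDen, cfBack]
    push_cast
    rw [ih]
    field_simp

/-- The linear form `q α - p` at the `n`-th convergent. -/
noncomputable def convErr (c : ℤ) (d : ℕ → ℕ+) (n : ℕ) : ℝ :=
  convDen d n * (c + (cfFull d)⁻¹) - convNum c d n

theorem convErr_succ (c : ℤ) (d : ℕ → ℕ+) (n : ℕ) :
    convErr c d (n + 1) = -convErr c d n * (cfFull fun k => d (n + 1 + k))⁻¹ := by
  induction n with
  | zero =>
    have h0 := cfFull_pos d
    have h1 := cfFull_tail_eq d 0
    have h2 := cfFull_pos fun k => d (0 + 1 + k)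
    simp only [zero_add] at h1 h2
    simp only [convErr, convDen, convNum, zero_add]
    push_cast
    have : cfFull d ≠ 0 := h0.ne'
    field_simp
    field_simp at h1
    linarith
  | succ n ih =>
    have h1 := cfFull_tail_eq d (n + 1)
    have hx := cfFull_pos fun k => d (n + 1 + k)
    have hrec : convErr c d (n + 2) = (d (n + 1) : ℕ) * convErr c d (n + 1) + convErr c d n := by
      simp only [convErr, convDen, convNum]
      push_cast
      ring
    have hn : convErr c d n = -convErr c d (n + 1) * cfFull fun k => d (n + 1 + k) := by
      rw [ih]
      field_simp
    rw [hrec]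
    rw [hn, h1]
    ring

/-- The quantity `|q_n α - p_n| (q_{n+1} + q_n / x_{n+1})`, with `x_{n+1}` the complete quotient
starting at `d (n + 1)`, does not depend on `n`. -/
theorem convErr_mul (c : ℤ) (d : ℕ → ℕ+) (n : ℕ) :
    convDen d n * |convErr c d n| * oneLambda d n = 1 := by
  suffices H : |convErr c d n| *
      (convDen d (n + 1) + convDen d n * (cfFull fun k => d (n + 1 + k))⁻¹) = 1 by
    rw [oneLambda, ← H, convDen_succ_eq]
    ring
  induction n with
  | zero =>
    have h0 := cfFull_pos d
    have h1 := cfFull_tail_eq d 0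
    simp only [zero_add] at h1
    have he : convErr c d 0 = (cfFull d)⁻¹ := by simp [convErr, convDen, convNum]
    rw [he, abs_of_pos (inv_pos.2 h0)]
    simp only [convDen, zero_add, Nat.cast_one, one_mul]
    rw [← h1]
    exact inv_mul_cancel₀ h0.ne'
  | succ n ih =>
    have h1 := cfFull_tail_eq d (n + 1)
    have hx := cfFull_pos fun k => d (n + 1 + k)
    rw [← ih, convErr_succ, abs_mul, abs_neg, abs_of_pos (inv_pos.2 hx)]
    have : (convDen d (n + 1 + 1) : ℝ) + convDen d (n + 1) * (cfFull fun k => d (n + 1 + 1 + k))⁻¹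
        = convDen d (n + 1) * (cfFull fun k => d (n + 1 + k)) + convDen d n := by
      rw [h1]
      simp only [convDen]
      push_cast
      ring
    rw [this]
    field_simp

theorem oneLambda_pos (d : ℕ → ℕ+) (n : ℕ) : 0 < oneLambda d n := by
  have := one_le_cfBack d n
  have := inv_pos.2 (cfFull_pos fun k => d (n + 1 + k))
  rw [oneLambda]
  linarith

theorem convDen_mul_convErr (c : ℤ) (d : ℕ → ℕ+) (n : ℕ) :
    |(convDen d n : ℝ) * convErr c d n| = (oneLambda d n)⁻¹ := by
  rw [abs_mul, Nat.abs_cast]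
  exact eq_inv_of_mul_eq_one_left (convErr_mul c d n)

theorem convNum_convDen_det (c : ℤ) (d : ℕ → ℕ+) (n : ℕ) :
    convNum c d (n + 1) * convDen d n - convNum c d n * convDen d (n + 1) = (-1) ^ n := by
  induction n with
  | zero => simp [convNum, convDen]; ring
  | succ n ih =>
    simp only [convNum, convDen]
    push_cast
    rw [pow_succ, ← ih]
    ring

theorem isCoprime_convNum_convDen (c : ℤ) (d : ℕ → ℕ+) (n : ℕ) :
    IsCoprime (convNum c d n) (convDen d n : ℤ) := by
  have h := convNum_convDen_det c d n
  refine ⟨-(-1) ^ n * convDen d (n + 1), (-1) ^ n * convNum c d (n + 1), ?_⟩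
  have h2 : ((-1 : ℤ) ^ n) * (-1) ^ n = 1 := by rw [← mul_pow]; simp
  calc _ = (-1) ^ n * (convNum c d (n + 1) * convDen d n - convNum c d n * convDen d (n + 1)) := by
        ring
    _ = 1 := by rw [h, h2]

theorem floor_add_inv_cfFull (c : ℤ) (d : ℕ → ℕ+) : ⌊(c : ℝ) + (cfFull d)⁻¹⌋ = c := by
  have h0 := inv_pos.2 (cfFull_pos d)
  have h1 := inv_lt_one_of_one_lt₀ (one_lt_cfFull d)
  rw [Int.floor_eq_iff]
  constructor <;> linarith

theorem inv_fract_add_inv_cfFull (c : ℤ) (d : ℕ → ℕ+) :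
    (Int.fract ((c : ℝ) + (cfFull d)⁻¹))⁻¹ = cfFull d := by
  rw [Int.fract, floor_add_inv_cfFull, add_sub_cancel_left, inv_inv]

/-- Identifies the hand-made convergents with `Real.convergent`, for which Legendre's theorem is
stated. -/
theorem convergent_add_inv_cfFull (c : ℤ) (d : ℕ → ℕ+) (n : ℕ) :
    (((c : ℝ) + (cfFull d)⁻¹).convergent n : ℝ) = convNum c d n / convDen d n := by
  have hs : ∀ (n : ℕ) (c : ℤ) (d : ℕ → ℕ+),
      (GenContFract.of ((c : ℝ) + (cfFull d)⁻¹)).s.get? n = some ⟨1, ((d n : ℕ) : ℝ)⟩ := by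
    intro n
    induction n with
    | zero =>
      intro c d
      have hne : Int.fract ((c : ℝ) + (cfFull d)⁻¹) ≠ 0 := fun h => by
        have := inv_fract_add_inv_cfFull c d
        rw [h, inv_zero] at this
        exact (cfFull_pos d).ne this
      refine (GenContFract.of_s_head hne).trans ?_
      rw [inv_fract_add_inv_cfFull, cfFull_eq]
      have := floor_add_inv_cfFull (d 0 : ℕ) fun n => d (n + 1)
      rw [Int.cast_natCast] at this
      rw [this, Int.cast_natCast]
    | succ n ih =>
      intro c d
      rw [GenContFract.of_s_succ, inv_fract_add_inv_cfFull, cfFull_eq]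
      have := ih (d 0 : ℕ) fun n => d (n + 1)
      rwa [Int.cast_natCast] at this
  set g := GenContFract.of ((c : ℝ) + (cfFull d)⁻¹) with hg
  have hh : g.h = c := by
    rw [hg, GenContFract.of_h_eq_floor, floor_add_inv_cfFull]
  have hd : g.nums n = convNum c d n ∧ g.dens n = convDen d n := by
    induction n using Nat.twoStepInduction with
    | zero => simp [convNum, convDen, hh]
    | one =>
      rw [GenContFract.first_num_eq (hs 0 c d), GenContFract.first_den_eq (hs 0 c d)]
      constructor
      · rw [hh]
        simp [convNum]
      · rfl
    | more n h0 h1 =>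
      rw [GenContFract.nums_recurrence (hs (n + 1) c d) h0.1 h1.1,
        GenContFract.dens_recurrence (hs (n + 1) c d) h0.2 h1.2]
      simp [convNum, convDen]
  rw [← Real.convs_eq_convergent, ← hg, GenContFract.conv_eq_num_div_den, hd.1, hd.2]

/-- Pairs giving a good rational approximation are multiples of convergents. -/
theorem exists_convergent_of_abs_lt (c : ℤ) (d : ℕ → ℕ+) (p : ℤ) (q : ℕ+)
    (h : |((q : ℕ) : ℝ) * ((q : ℕ) * (c + (cfFull d)⁻¹) - p)| < 1 / 2) :
    ∃ n k : ℕ, 0 < k ∧ (q : ℕ) = k * convDen d n ∧ p = k * convNum c d n := by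
  set α := (c : ℝ) + (cfFull d)⁻¹ with hα
  have hq : (0 : ℝ) < (q : ℕ) := Nat.cast_pos.2 q.pos
  set r : ℚ := p / (q : ℕ) with hr
  have hrr : (r : ℝ) = p / (q : ℕ) := by rw [hr]; push_cast; rfl
  have hden : r.den ≤ (q : ℕ) := by
    refine Nat.le_of_dvd q.pos ?_
    have := Rat.den_dvd p (q : ℕ)
    rw [Rat.divInt_eq_div, Int.cast_natCast, ← hr] at this
    exact Int.natCast_dvd_natCast.1 this
  have hden0 : (0 : ℝ) < r.den := Nat.cast_pos.2 r.pos
  have hden' : (r.den : ℝ) ≤ (q : ℕ) := by exact_mod_cast hden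
  obtain ⟨n, hn⟩ := Real.exists_rat_eq_convergent (ξ := α) (q := r) (by
    have e : ((q : ℕ) : ℝ) * ((q : ℕ) * α - p) = (q : ℕ) ^ 2 * (α - r) := by
      rw [hrr]; field_simp
    rw [e, abs_mul, abs_of_pos (by positivity)] at h
    have : |α - r| < 1 / (2 * ((q : ℕ) : ℝ) ^ 2) := by
      rw [lt_div_iff₀ (by positivity)]
      linarith
    refine this.trans_le ?_
    gcongr)
  have hn' : (r : ℝ) = convNum c d n / convDen d n := by
    rw [← convergent_add_inv_cfFull, ← hα, ← hn]
  have hD : (0 : ℝ) < convDen d n := Nat.cast_pos.2 (convDen_pos d n)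
  rw [hrr, div_eq_div_iff hq.ne' hD.ne'] at hn'
  have hz : p * (convDen d n : ℤ) = convNum c d n * ((q : ℕ) : ℤ) := by exact_mod_cast hn'
  have hdvd : (convDen d n : ℤ) ∣ ((q : ℕ) : ℤ) :=
    (isCoprime_convNum_convDen c d n).symm.dvd_of_dvd_mul_left ⟨p, by rw [← hz, mul_comm]⟩
  obtain ⟨k, hk⟩ := Int.natCast_dvd_natCast.1 hdvd
  refine ⟨n, k, ?_, by rw [hk, mul_comm], ?_⟩
  · rcases Nat.eq_zero_or_pos k with h0 | h0
    · rw [h0, mul_zero] at hk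
      exact absurd hk q.ne_zero
    · exact h0
  · have : (convDen d n : ℤ) ≠ 0 := by exact_mod_cast (convDen_pos d n).ne'
    refine mul_right_cancel₀ this ?_
    rw [hz, hk]
    push_cast
    ring

/-- The `n`-th convergent as a pair. -/
def convPair (c : ℤ) (d : ℕ → ℕ+) (n : ℕ) : ℤ × ℕ+ :=
  (convNum c d n, ⟨convDen d n, convDen_pos d n⟩)

/-- `|q (q α - p)|` for `α = c + [0; d 0, d 1, …]`. -/
noncomputable def approxVal (c : ℤ) (d : ℕ → ℕ+) (x : ℤ × ℕ+) : ℝ :=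
  |((x.2 : ℕ) : ℝ) * (((x.2 : ℕ) : ℝ) * (c + (cfFull d)⁻¹) - (x.1 : ℝ))|

theorem approxVal_convPair (c : ℤ) (d : ℕ → ℕ+) (n : ℕ) :
    approxVal c d (convPair c d n) = (oneLambda d n)⁻¹ :=
  convDen_mul_convErr c d n

theorem tendsto_convPair (c : ℤ) (d : ℕ → ℕ+) :
    Tendsto (convPair c d) atTop cofinite := by
  have : Tendsto (fun n => ((convPair c d n).2 : ℕ)) atTop cofinite := by
    rw [Nat.cofinite_eq_atTop]
    exact tendsto_atTop_mono (le_convDen d) tendsto_id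
  rw [tendsto_def] at this ⊢
  intro s hs
  rw [mem_cofinite] at hs
  have h2 := this (((fun x : ℤ × ℕ+ => (x.2 : ℕ)) '' sᶜ)ᶜ) (by
    rw [mem_cofinite, compl_compl]; exact hs.image _)
  filter_upwards [h2] with n hn
  by_contra hns
  exact hn ⟨_, hns, rfl⟩

/-- If `λ_n` exceeds `t > 2` only finitely often, then only finitely many pairs approximate with
quality `1 / t`. -/
theorem finite_approxVal_le (c : ℤ) (d : ℕ → ℕ+) {t : ℝ} (ht : 2 < t)
    (hfin : {n | t ≤ oneLambda d n}.Finite) : {x | approxVal c d x ≤ t⁻¹}.Finite := by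
  have ht0 : 0 < t := by linarith
  obtain ⟨C, hC⟩ : ∃ C : ℕ, ∀ n ∈ {n | t ≤ oneLambda d n}, oneLambda d n ≤ C := by
    obtain ⟨C, hC⟩ := (hfin.image (oneLambda d)).bddAbove
    obtain ⟨C', hC'⟩ := exists_nat_ge C
    exact ⟨C', fun n hn => (hC ⟨n, hn, rfl⟩).trans hC'⟩
  -- A good pair is `k` times the `n`-th convergent with `k² t ≤ λ_n`, so `t ≤ λ_n` and `k ≤ C`:
  -- finitely many `n` and `k` remain.
  refine ((hfin.prod (Set.finite_Iic C)).image fun nk : ℕ × ℕ =>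
    ((nk.2 * convNum c d nk.1, nk.2 * convDen d nk.1) : ℤ × ℕ)).preimage
    (f := fun x : ℤ × ℕ+ => ((x.1, (x.2 : ℕ)) : ℤ × ℕ)) ?_ |>.subset ?_
  · intro x _ y _ hxy
    simp only [Prod.mk.injEq] at hxy
    exact Prod.ext hxy.1 (PNat.coe_injective hxy.2)
  · rintro ⟨p, q⟩ hx
    have hx' : approxVal c d (p, q) ≤ t⁻¹ := hx
    obtain ⟨n, k, hk, hq, hp⟩ := exists_convergent_of_abs_lt c d p q
      (hx'.trans_lt (by rw [inv_lt_comm₀ ht0 (by norm_num)]; linarith))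
    have hl := oneLambda_pos d n
    have hk1 : (1 : ℝ) ≤ k := by exact_mod_cast hk
    have hval : approxVal c d (p, q) = k ^ 2 * (oneLambda d n)⁻¹ := by
      rw [← convDen_mul_convErr c d n, approxVal, hq, hp, convErr,
        ← abs_of_nonneg (show (0 : ℝ) ≤ k ^ 2 by positivity), ← abs_mul]
      push_cast
      congr 1
      ring
    rw [hval, ← div_eq_mul_inv, div_le_iff₀ hl, inv_mul_eq_div, le_div_iff₀ ht0] at hx'
    have hkk : (k : ℝ) ≤ k ^ 2 := by nlinarith
    have hn : t ≤ oneLambda d n := by nlinarith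
    refine ⟨(n, k), ⟨hn, ?_⟩, by simp [hq, hp]⟩
    have : (k : ℝ) ≤ C := by
      have := hC n hn
      nlinarith
    exact_mod_cast this

/-! ### The Lagrange constant as an upper limit of `λ_n` -/

theorem infinite_approxVal_le_iff (c : ℤ) (d : ℕ → ℕ+) {t : ℝ} (ht : 2 < t) :
    {x | approxVal c d x ≤ t⁻¹}.Infinite ↔ {n | t ≤ oneLambda d n}.Infinite := by
  refine ⟨fun h hfin => h (finite_approxVal_le c d ht hfin), fun h => ?_⟩
  rw [← Nat.frequently_atTop_iff_infinite] at h
  rw [← frequently_cofinite_iff_infinite]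
  refine (tendsto_convPair c d).frequently (h.mono fun n hn => ?_)
  rw [approxVal_convPair]
  exact inv_anti₀ (by linarith) hn

/-- Keeps Lagrange constants above `2`, inside Legendre's range. If the bound failed from some point
on, digits would be at most `2`, then all `1` since `2 + 1/3 > 41/20`; but then `λ_n` tends to `√5`.
The value `41/20` is a convenient number between `2` and `√5` for which crude bounds suffice. -/
theorem frequently_oneLambda_gt (d : ℕ → ℕ+) : ∃ᶠ n in atTop, 41 / 20 ≤ oneLambda d n := by
  rw [frequently_atTop]
  intro N
  by_contra! H
  have hpos : ∀ n, 0 < (cfFull fun k => d (n + 1 + k))⁻¹ := fun n => inv_pos.2 (cfFull_pos _)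
  have hle2 : ∀ n ≥ N, ((d n : ℕ) : ℝ) ≤ 2 := by
    intro n hn
    by_contra! h
    have h3 : 3 ≤ (d n : ℕ) := by exact_mod_cast h
    have h3' : (3 : ℝ) ≤ (d n : ℕ) := by exact_mod_cast h3
    have := H n hn
    rw [oneLambda] at this
    linarith [coe_le_cfBack d n, hpos n]
  have hback : ∀ n ≥ N, (1 / 3 : ℝ) ≤ (cfBack d n)⁻¹ := by
    intro n hn
    have h := inv_anti₀ (one_pos.trans_le (one_le_cfBack d n))
      ((cfBack_le d n).trans (add_le_add_left (hle2 n hn) 1))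
    norm_num at h ⊢
    exact h
  have heq1 : ∀ n ≥ N + 1, ((d n : ℕ) : ℝ) = 1 := by
    intro n hn
    by_contra h
    have h2 : 2 ≤ (d n : ℕ) := by
      have := (d n).pos
      have h' : (d n : ℕ) ≠ 1 := by exact_mod_cast h
      omega
    have h2' : (2 : ℝ) ≤ (d n : ℕ) := by exact_mod_cast h2
    obtain ⟨m, rfl⟩ : ∃ m, n = m + 1 := ⟨n - 1, by omega⟩
    have h3 := H (m + 1) (by omega)
    rw [oneLambda, cfBack] at h3
    linarith [hback m (by omega), hpos (m + 1)]
  have hlam := H (N + 2) (by omega)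
  rw [oneLambda, cfBack, heq1 (N + 2) (by omega)] at hlam
  have hb : (1 / 2 : ℝ) ≤ (cfBack d (N + 1))⁻¹ := by
    have h := inv_anti₀ (one_pos.trans_le (one_le_cfBack d (N + 1))) (cfBack_le d (N + 1))
    rw [heq1 _ le_rfl] at h
    norm_num at h ⊢
    exact h
  have hx2 : (cfFull fun k => d (N + 4 + 1 + k))⁻¹ ≤ 1 :=
    inv_le_one_of_one_le₀ (one_le_cfFull _)
  have hx1 := cfFull_tail_eq d (N + 4)
  rw [heq1 _ (by omega)] at hx1
  have hx0 := cfFull_tail_eq d (N + 3)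
  rw [heq1 _ (by omega)] at hx0
  have h3 : (cfFull fun k => d (N + 3 + k))⁻¹ ≤ (41 / 20 - 3 / 2 : ℝ) := by
    have := H (N + 2) (by omega)
    rw [oneLambda, cfBack, heq1 (N + 2) (by omega)] at this
    change _ + (cfFull fun k => d (N + 3 + k))⁻¹ < _ at this
    linarith
  have h4 : (20 / 11 : ℝ) ≤ cfFull fun k => d (N + 3 + k) := by
    rw [inv_le_comm₀ (cfFull_pos _) (by norm_num)] at h3
    norm_num at h3 ⊢
    linarith
  have h5 : (cfFull fun k => d (N + 4 + k)) ≤ 11 / 9 := by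
    have : (9 / 11 : ℝ) ≤ (cfFull fun k => d (N + 4 + k))⁻¹ := by
      change _ = 1 + (cfFull fun k => d (N + 4 + k))⁻¹ at hx0
      linarith
    rw [le_inv_comm₀ (by norm_num) (cfFull_pos _)] at this
    norm_num at this
    linarith
  have h6 : (cfFull fun k => d (N + 4 + 1 + k))⁻¹ ≤ 2 / 9 := by linarith
  have h7 : (9 / 2 : ℝ) ≤ cfFull fun k => d (N + 5 + k) := by
    rw [inv_le_comm₀ (cfFull_pos _) (by norm_num)] at h6
    norm_num at h6 ⊢
    exact h6
  have hx3 := cfFull_tail_eq d (N + 5)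
  rw [heq1 _ (by omega)] at hx3
  have : (cfFull fun k => d (N + 5 + 1 + k))⁻¹ ≤ 1 :=
    inv_le_one_of_one_le₀ (one_le_cfFull _)
  linarith

/-- Convergents are among the pairs, which gives one inequality of lower limits. For the other, the
lower limit along convergents is at most `20/41 < 1/2`, and below it Legendre leaves only finitely
many pairs. -/
theorem lagrangeConst_eq_limsup (c : ℤ) (d : ℕ → ℕ+) :
    lagrangeConst (c + (cfFull d)⁻¹) =
      ((limsup (fun n => ENNReal.ofReal (oneLambda d n)) atTop : ℝ≥0∞) : EReal) := by
  rw [lagrangeConst]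
  congr 1
  have hw : (fun n => ENNReal.ofReal (oneLambda d n)) =
      fun n => (ENNReal.ofReal (approxVal c d (convPair c d n)))⁻¹ := by
    funext n
    rw [approxVal_convPair, ENNReal.ofReal_inv_of_pos (oneLambda_pos d n), inv_inv]
  rw [hw, ← ENNReal.inv_liminf]
  congr 1
  refine le_antisymm (tendsto_convPair c d).liminf_le_liminf_comp ?_
  refine le_of_forall_lt fun b hb => ?_
  have hb1 : b < ENNReal.ofReal (41 / 20 : ℝ)⁻¹ := by
    refine hb.trans_le (liminf_le_of_frequently_le ?_)
    refine (frequently_oneLambda_gt d).mono fun n hn => ?_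
    change ENNReal.ofReal (approxVal c d (convPair c d n)) ≤ _
    rw [approxVal_convPair]
    exact ENNReal.ofReal_le_ofReal (inv_anti₀ (by norm_num) hn)
  obtain ⟨b', hbb', hb'⟩ := exists_between (lt_min hb hb1)
  obtain ⟨hb'0, hb'1⟩ := lt_min_iff.1 hb'
  have hb'top : b' ≠ ⊤ := (hb'1.trans ENNReal.ofReal_lt_top).ne
  set s := b'.toReal with hs
  have hs0 : 0 < s := ENNReal.toReal_pos (bot_le.trans_lt hbb').ne' hb'top
  have hbs : b' = ENNReal.ofReal s := (ENNReal.ofReal_toReal hb'top).symm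
  have hs1 : s < (41 / 20 : ℝ)⁻¹ := by
    rw [hbs] at hb'1
    exact (ENNReal.ofReal_lt_ofReal_iff (by norm_num)).1 hb'1
  have ht : 2 < s⁻¹ := by
    have := (lt_inv_comm₀ hs0 (by norm_num)).1 hs1
    linarith
  have hfin := finite_approxVal_le c d ht (by
    have := eventually_lt_of_lt_liminf hb'0
    rw [← Nat.cofinite_eq_atTop] at this
    refine Set.Finite.subset this fun n hn => ?_
    have hn' : s⁻¹ ≤ oneLambda d n := hn
    change ¬ b' < ENNReal.ofReal (approxVal c d (convPair c d n))
    rw [not_lt, approxVal_convPair, hbs]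
    refine ENNReal.ofReal_le_ofReal ?_
    rwa [inv_le_comm₀ (oneLambda_pos d n) hs0])
  refine hbb'.trans_le (le_liminf_of_le ?_ ?_)
  · isBoundedDefault
  · rw [inv_inv] at hfin
    refine Set.Finite.subset hfin fun x hx => ?_
    have hx' : ¬ b' ≤ ENNReal.ofReal (approxVal c d x) := hx
    rw [not_le, hbs] at hx'
    exact ((ENNReal.ofReal_lt_ofReal_iff hs0).1 hx').le

theorem eventually_oneLambda_lt {c : ℤ} {d : ℕ → ℕ+} {x : ℝ}
    (h : lagrangeConst (c + (cfFull d)⁻¹) = (x : EReal)) {y : ℝ} (hy : x < y) :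
    ∀ᶠ n in atTop, oneLambda d n < y := by
  rw [lagrangeConst_eq_limsup] at h
  set L := limsup (fun n => ENNReal.ofReal (oneLambda d n)) atTop with hL
  have hlt : (L : EReal) < ((ENNReal.ofReal y : ℝ≥0∞) : EReal) := by
    rw [h, EReal.coe_ennreal_ofReal]
    exact EReal.coe_lt_coe_iff.2 (lt_max_of_lt_left hy)
  filter_upwards [eventually_lt_of_limsup_lt (EReal.coe_ennreal_lt_coe_ennreal_iff.1 hlt)]
    with n hn
  exact (ENNReal.ofReal_lt_ofReal_iff_of_nonneg (oneLambda_pos d n).le).1 hn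

theorem two_lt_of_lagrangeConst_eq {c : ℤ} {d : ℕ → ℕ+} {x : ℝ}
    (h : lagrangeConst (c + (cfFull d)⁻¹) = (x : EReal)) : 2 < x := by
  by_contra! hx
  obtain ⟨n, hn1, hn2⟩ := ((frequently_oneLambda_gt d).and_eventually
    (eventually_oneLambda_lt h (show x < 41 / 20 by linarith))).exists
  linarith

theorem lagrangeConst_eq_of {c : ℤ} {d : ℕ → ℕ+} {x : ℝ} (hx : 0 ≤ x)
    (h1 : ∀ y > x, ∀ᶠ n in atTop, oneLambda d n ≤ y)
    (h2 : ∀ y < x, ∃ᶠ n in atTop, y ≤ oneLambda d n) :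
    lagrangeConst (c + (cfFull d)⁻¹) = (x : EReal) := by
  rw [lagrangeConst_eq_limsup]
  suffices H : limsup (fun n => ENNReal.ofReal (oneLambda d n)) atTop = ENNReal.ofReal x by
    rw [H, EReal.coe_ennreal_ofReal, max_eq_left hx]
  refine le_antisymm ?_ ?_
  · refine le_of_forall_gt_imp_ge_of_dense fun y hy => ?_
    rcases eq_or_ne y ⊤ with rfl | hytop
    · exact le_top
    rw [← ENNReal.ofReal_toReal hytop] at hy ⊢
    have hy' := (ENNReal.ofReal_lt_ofReal_iff_of_nonneg hx).1 hy
    exact limsup_le_of_le (by isBoundedDefault)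
      ((h1 _ hy').mono fun n hn => ENNReal.ofReal_le_ofReal hn)
  · refine le_of_forall_lt_imp_le_of_dense fun y hy => ?_
    have hytop := (hy.trans ENNReal.ofReal_lt_top).ne
    rw [← ENNReal.ofReal_toReal hytop] at hy ⊢
    have hy' := (ENNReal.ofReal_lt_ofReal_iff_of_nonneg ENNReal.toReal_nonneg).1 hy
    exact le_limsup_of_frequently_le
      ((h2 _ hy').mono fun n hn => ENNReal.ofReal_le_ofReal hn) (by isBoundedDefault)

/-- As `x > 2`, the non-strict inequality is still in Legendre's range, and each convergent
contributes only finitely many multiples. -/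
theorem isAttainable_iff {c : ℤ} {d : ℕ → ℕ+} {x : ℝ}
    (h : lagrangeConst (c + (cfFull d)⁻¹) = (x : EReal)) :
    IsAttainable (c + (cfFull d)⁻¹) ↔ {n | x ≤ oneLambda d n}.Infinite := by
  have hx := two_lt_of_lagrangeConst_eq h
  rw [← infinite_approxVal_le_iff c d hx, IsAttainable, h, EReal.toReal_coe]
  refine Eq.to_iff (congrArg Set.Infinite (Set.ext fun y => ?_))
  have hq : (0 : ℝ) < (y.2 : ℕ) := Nat.cast_pos.2 y.2.pos
  have e : ((y.2 : ℕ) : ℝ) * ((y.2 : ℕ) * (c + (cfFull d)⁻¹) - y.1) =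
      (y.2 : ℕ) ^ 2 * ((c + (cfFull d)⁻¹) - y.1 / (y.2 : ℕ)) := by
    field_simp
  rw [Set.mem_ofPred_eq, Set.mem_ofPred_eq, approxVal, e, abs_mul,
    abs_of_pos (show (0 : ℝ) < ((y.2 : ℕ) : ℝ) ^ 2 by positivity), le_div_iff₀ (by positivity),
    ← one_div x, le_div_iff₀ (by linarith), mul_comm x, ← mul_assoc, mul_comm (|_|)]

/-- Every irrational number has an infinite continued fraction expansion. -/
theorem exists_eq_add_inv_cfFull {α : ℝ} (hα : Irrational α) :
    ∃ (c : ℤ) (d : ℕ → ℕ+), α = c + (cfFull d)⁻¹ := by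
  let x : ℕ → ℝ := fun n => Nat.rec (Int.fract α)⁻¹ (fun _ y => (Int.fract y)⁻¹) n
  have hirr : ∀ {y : ℝ}, Irrational y → Irrational (Int.fract y)⁻¹ := fun {y} hy => by
    rw [irrational_inv_iff]
    exact hy.sub_intCast _
  have hx : ∀ n, Irrational (x n) := fun n => by
    induction n with
    | zero => exact hirr hα
    | succ n ih => exact hirr ih
  have hgt : ∀ {y : ℝ}, Irrational y → 1 < (Int.fract y)⁻¹ := fun {y} hy => by
    refine (one_lt_inv₀ (Int.fract_pos.2 fun h => ?_)).2 (Int.fract_lt_one y)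
    exact hy ⟨⌊y⌋, by rw [h]; simp⟩
  have hx1 : ∀ n, 1 < x n := fun n => by
    cases n with
    | zero => exact hgt hα
    | succ n => exact hgt (hx n)
  have hpos : ∀ n, 0 < ⌊x n⌋.toNat := fun n => by
    have : 1 ≤ ⌊x n⌋ := Int.le_floor.2 (by exact_mod_cast (hx1 n).le)
    omega
  let d : ℕ → ℕ+ := fun n => ⟨⌊x n⌋.toNat, hpos n⟩
  have hrec : ∀ n, x n = (d n : ℕ) + (x (n + 1))⁻¹ := fun n => by
    have h1 : ((d n : ℕ) : ℝ) = ⌊x n⌋ := by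
      have : ((⌊x n⌋.toNat : ℕ) : ℤ) = ⌊x n⌋ := Int.toNat_of_nonneg (by have := hpos n; omega)
      exact_mod_cast this
    have h2 : x (n + 1) = (Int.fract (x n))⁻¹ := rfl
    rw [h1, h2, inv_inv, Int.floor_add_fract]
  refine ⟨⌊α⌋, d, ?_⟩
  have hlim : ∀ m : ℕ, |x 0 - cfFull d| ≤ (1 / 4) ^ m := fun m => by
    have := abs_sub_le_of_rec m (x := x) (y := fun k => cfFull fun i => d (k + i)) (e := d)
      (fun k _ => hrec k) (fun k _ => cfFull_tail_eq d k) (fun k _ => (hx1 k).le)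
      (fun k _ => one_le_cfFull _)
      (abs_sub_le_one_of_rec (hrec _) (cfFull_tail_eq d _)
        (hx1 (2 * m + 1)).le (one_le_cfFull _))
    simpa using this
  have h0 : |x 0 - cfFull d| ≤ 0 :=
    ge_of_tendsto' (tendsto_pow_atTop_nhds_zero_of_lt_one (by norm_num) (by norm_num)) hlim
  rw [← sub_eq_zero.1 (abs_nonpos_iff.1 h0)]
  change α = ⌊α⌋ + (Int.fract α)⁻¹⁻¹
  rw [inv_inv, Int.floor_add_fract]

theorem irrational_add_inv_cfFull (c : ℤ) (d : ℕ → ℕ+) : Irrational (c + (cfFull d)⁻¹) :=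
  (irrational_inv_iff.2 (irrational_cfFull d)).intCast_add c

/-! ### Periodic sequences -/

theorem eventually_abs_oneLambda_sub_lt {d : ℕ → ℕ+} {B : ℤ → ℕ+} (h : ∀ k, d k = B (1 + k))
    {ε : ℝ} (hε : 0 < ε) :
    ∀ᶠ n : ℕ in atTop, |oneLambda d n - biLambda B (1 + n)| < ε := by
  have hlim : Tendsto (fun m : ℕ => 2 * (1 / 4 : ℝ) ^ m) atTop (𝓝 0) := by
    simpa using (tendsto_pow_atTop_nhds_zero_of_lt_one (by norm_num : (0 : ℝ) ≤ 1 / 4)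
      (by norm_num)).const_mul 2
  obtain ⟨m, hm⟩ := (hlim.eventually (gt_mem_nhds hε)).exists
  filter_upwards [eventually_gt_atTop (2 * m)] with n hn
  refine (abs_oneLambda_sub_biLambda_le hn fun k hk _ => ?_).trans_lt hm
  rw [h]
  congr 1
  omega

theorem biLambda_periodic {B : ℤ → ℕ+} {T : ℤ} (h : Function.Periodic B T) :
    Function.Periodic (biLambda B) T := by
  intro i
  have e1 : ∀ n : ℕ, B (i + T - n) = B (i - n) := fun n => by
    rw [← h (i - n)]; congr 1; ring
  have e2 : ∀ n : ℕ, B (i + T + 1 + n) = B (i + 1 + n) := fun n => by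
    rw [← h (i + 1 + n)]; congr 1; ring
  rw [biLambda_eq, biLambda_eq]
  simp only [e1, e2]

theorem biLambda_pos (B : ℤ → ℕ+) (i : ℤ) : 0 < biLambda B i := by
  rw [biLambda_eq]
  have := cfFull_pos fun n : ℕ => B (i - n)
  have := inv_pos.2 (cfFull_pos fun n : ℕ => B (i + 1 + n))
  linarith

/-- The Lagrange constant of a periodic continued fraction. -/
theorem lagrangeConst_of_periodic {B : ℤ → ℕ+} {T : ℕ} (hT : 0 < T)
    (h : Function.Periodic B (T : ℤ)) {j : ℤ} {x : ℝ} (hj : biLambda B j = x)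
    (hle : ∀ i, biLambda B i ≤ x) :
    lagrangeConst (((0 : ℤ) : ℝ) + (cfFull fun k : ℕ => B (1 + k))⁻¹) = (x : EReal) := by
  refine lagrangeConst_eq_of (hj ▸ (biLambda_pos B j).le) (fun y hy => ?_) fun y hy => ?_
  · filter_upwards [eventually_abs_oneLambda_sub_lt (d := fun k : ℕ => B (1 + k)) (B := B)
      (fun _ => rfl) (sub_pos.2 hy)] with n hn
    have := (abs_lt.1 hn).2
    have := hle (1 + n)
    linarith
  · have hev := eventually_abs_oneLambda_sub_lt (d := fun k : ℕ => B (1 + k)) (B := B)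
      (fun _ => rfl) (sub_pos.2 hy)
    have hfr : ∃ᶠ n : ℕ in atTop, biLambda B (1 + n) = x := by
      rw [frequently_atTop]
      intro N
      have hbig : (1 : ℤ) ≤ T := by exact_mod_cast hT
      -- The multiple of `T` is large enough that `n ≥ N`, while `1 + n ≡ j` modulo `T`.
      obtain ⟨n, hn⟩ := Int.eq_ofNat_of_zero_le
        (show 0 ≤ j - 1 + (N + |j| + 1) * T by
          have := neg_abs_le j
          have := abs_nonneg j
          nlinarith)
      refine ⟨n, ?_, ?_⟩
      · have h1 : (N : ℤ) ≤ n := by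
          rw [← hn]
          have := neg_abs_le j
          have := abs_nonneg j
          nlinarith
        exact_mod_cast h1
      · rw [← hj, ← (biLambda_periodic h).int_mul (N + |j| + 1) j, ← hn]
        congr 1
        simp only [Int.cast_id]
        ring
    refine (hfr.and_eventually hev).mono fun n hn => ?_
    have := (abs_lt.1 hn.2).1
    linarith [hn.1]

theorem exists_max_biLambda_of_periodic {B : ℤ → ℕ+} {T : ℕ} (hT : 0 < T)
    (h : Function.Periodic B (T : ℤ)) : ∃ j, ∀ i, biLambda B i ≤ biLambda B j := by
  obtain ⟨j, -, hj⟩ := (Finset.Ico (0 : ℤ) T).exists_max_image (biLambda B)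
    ⟨0, Finset.mem_Ico.2 ⟨le_rfl, by exact_mod_cast hT⟩⟩
  refine ⟨j, fun i => ?_⟩
  obtain ⟨y, hy, hy'⟩ := (biLambda_periodic h).exists_mem_Ico₀ (by exact_mod_cast hT) i
  rw [hy']
  exact hj y (Finset.mem_Ico.2 hy)

/-- Left of a gap, periodic sequences below the right endpoint are below the left endpoint. -/
theorem biLambda_le_of_periodic {a b : ℝ} (hab : IsMaximalGap a b) {B : ℤ → ℕ+} {T : ℕ}
    (hT : 0 < T) (h : Function.Periodic B (T : ℤ)) (hlt : ∀ i, biLambda B i < b) (i : ℤ) :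
    biLambda B i ≤ a := by
  obtain ⟨j, hj⟩ := exists_max_biLambda_of_periodic hT h
  refine (hj i).trans ?_
  by_contra! hgt
  have hmem : biLambda B j ∈ Set.Ioo a b ∩ lagrangeSpectrum :=
    ⟨⟨hgt, hlt j⟩, _, irrational_add_inv_cfFull 0 _, lagrangeConst_of_periodic hT h rfl hj⟩
  rw [hab.2.2.2] at hmem
  exact hmem

/-- Truncating a continued fraction after an even number of terms increases it, after an odd
number decreases it. -/
theorem cfBack_lt_and_gt {d : ℕ → ℕ+} {B : ℤ → ℕ+} (h : ∀ k, d k = B (1 + k)) (m : ℕ) :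
    cfBack d (2 * m) < cfFull (fun k : ℕ => B (1 + (2 * m : ℕ) - k)) ∧
      (cfFull fun k : ℕ => B (1 + (2 * m + 1 : ℕ) - k)) < cfBack d (2 * m + 1) := by
  have hrec : ∀ n : ℕ, (cfFull fun k : ℕ => B (1 + (n + 1 : ℕ) - k)) =
      (d (n + 1) : ℕ) + (cfFull fun k : ℕ => B (1 + n - k))⁻¹ := fun n => by
    rw [cfFull_eq, h]
    have e : ∀ k : ℕ, (1 + (n + 1 : ℕ) - (k + 1 : ℕ) : ℤ) = 1 + n - k := fun k => by
      push_cast; ring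
    simp only [e, Nat.cast_zero, sub_zero]
  have up : ∀ n : ℕ, cfBack d n < cfFull (fun k : ℕ => B (1 + n - k)) →
      (cfFull fun k : ℕ => B (1 + (n + 1 : ℕ) - k)) < cfBack d (n + 1) := fun n hn => by
    rw [hrec, cfBack]
    have := inv_strictAnti₀ (one_pos.trans_le (one_le_cfBack d n)) hn
    linarith
  have down : ∀ n : ℕ, (cfFull fun k : ℕ => B (1 + n - k)) < cfBack d n →
      cfBack d (n + 1) < cfFull fun k : ℕ => B (1 + (n + 1 : ℕ) - k) := fun n hn => by
    rw [hrec, cfBack]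
    have := inv_strictAnti₀ (cfFull_pos _) hn
    linarith
  have H : cfBack d (2 * m) < cfFull (fun k : ℕ => B (1 + (2 * m : ℕ) - k)) := by
    induction m with
    | zero =>
      rw [cfFull_eq]
      have := inv_pos.2 (cfFull_pos fun k : ℕ => B (1 + (2 * 0 : ℕ) - (k + 1 : ℕ)))
      simp only [mul_zero, cfBack, h, Nat.cast_zero, add_zero, sub_zero] at this ⊢
      linarith
    | succ m ih => exact down _ (up _ ih)
  exact ⟨H, up _ H⟩

theorem isAdmissible_of_periodic {a : ℝ} (ha : a ∈ lagrangeSpectrum) {B : ℤ → ℕ+}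
    (hB : IsPurelyPeriodic B) (h0 : biLambda B 0 = a) (hM : markoffM B = (a : EReal)) :
    IsAdmissible a := by
  obtain ⟨T, hT, hper⟩ := hB
  have hle : ∀ i, biLambda B i ≤ a := fun i => by
    rw [← EReal.coe_le_coe_iff, ← hM]
    exact le_iSup (fun i => (biLambda B i : EReal)) i
  have hα := lagrangeConst_of_periodic hT hper h0 hle
  refine ⟨ha, _, irrational_add_inv_cfFull 0 _, (isAttainable_iff hα).2 ?_, hα⟩
  rw [← Nat.frequently_atTop_iff_infinite, frequently_atTop]
  intro N
  have hN : N + 1 ≤ (N + 1) * T := Nat.le_mul_of_pos_right _ hT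
  -- Twice a period is even: the position `2 * m + 2` in `B` looks like `0`, and its truncated past
  -- has `2 * m + 2` digits, the parity for which truncation increases.
  obtain ⟨m, hm⟩ : ∃ m, 2 * ((N + 1) * T) = 2 * m + 2 := ⟨(N + 1) * T - 1, by omega⟩
  refine ⟨2 * m + 1, by omega, ?_⟩
  set d : ℕ → ℕ+ := fun k => B (1 + k) with hd
  have hbi : biLambda B (1 + (2 * m + 1 : ℕ)) = a := by
    rw [← h0, ← (biLambda_periodic hper).int_mul (2 * (N + 1)) 0]
    congr 1
    have : (2 * ((N + 1) * T) : ℤ) = 2 * m + 2 := by exact_mod_cast hm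
    push_cast
    linarith
  rw [oneLambda, ← hbi, biLambda_eq]
  refine add_le_add (cfBack_lt_and_gt (fun _ => rfl) m).2.le (le_of_eq ?_)
  congr 2
  funext k
  simp only [hd]
  congr 1
  push_cast
  ring

/-! ### Two-sided sequences whose windows occur in a given one-sided sequence -/

/-- The window of length `K` of `B` at `i` occurs in `d` at some position `≥ N`. -/
def HasWindow (d : ℕ → ℕ+) (N K : ℕ) (B : ℤ → ℕ+) (i : ℤ) : Prop :=
  ∃ n ≥ N, ∀ k < K, B (i + k) = d (n + k)

/-- The two-sided sequences all of whose windows of length `K` occur in `d` at positions `≥ N`. -/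
def windowShift (d : ℕ → ℕ+) (N K : ℕ) : Set (ℤ → ℕ+) := {B | ∀ i, HasWindow d N K B i}

/-- Every window of length `K` at a position `≥ N` occurs infinitely often. -/
def WindowsRecur (d : ℕ → ℕ+) (N K : ℕ) : Prop :=
  ∀ n ≥ N, ∀ m, ∃ n' ≥ m, ∀ k < K, d (n' + k) = d (n + k)

theorem finite_range_window {d : ℕ → ℕ+} {C : ℕ+} (hC : ∀ n, d n ≤ C) (K : ℕ) :
    (Set.range fun (n : ℕ) (k : Fin K) => d (n + k)).Finite := by
  refine (Set.Finite.pi' fun _ : Fin K => Set.finite_Iic C).subset ?_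
  rintro _ ⟨n, rfl⟩ k
  exact hC _

/-- Bounded digits leave finitely many windows of length `K`; past some point those that occur only
finitely often have all disappeared. -/
theorem eventually_windowsRecur {d : ℕ → ℕ+} {C : ℕ+} (hC : ∀ n, d n ≤ C) (K : ℕ) :
    ∀ᶠ N in atTop, WindowsRecur d N K := by
  set f : ℕ → Fin K → ℕ+ := fun n k => d (n + k) with hf
  have h : ∀ᶠ n in atTop, ∃ᶠ m in atTop, f m = f n := by
    have h1 : ∀ᶠ n in atTop, ∀ w ∈ Set.range f, (¬ ∃ᶠ m in atTop, f m = w) → f n ≠ w := by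
      rw [eventually_all_finite (finite_range_window hC K)]
      intro w _
      by_cases hw : ∃ᶠ m in atTop, f m = w
      · exact Eventually.of_forall fun n h => absurd hw h
      · exact (not_frequently.1 hw).mono fun n hn _ => hn
    filter_upwards [h1] with n hn
    by_contra hcon
    exact hn _ ⟨n, rfl⟩ hcon rfl
  obtain ⟨N, hN⟩ := eventually_atTop.1 h
  refine eventually_atTop.2 ⟨N, fun N' hN' n hn m => ?_⟩
  obtain ⟨n', hn', he⟩ := frequently_atTop.1 (hN n (hN'.trans hn)) m
  exact ⟨n', hn', fun k hk => congrFun he ⟨k, hk⟩⟩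

/-- Follow `B` up to position `i`, then continue with `C` from position `j` on. -/
def glue (B C : ℤ → ℕ+) (i j : ℤ) (t : ℤ) : ℕ+ := if t < i then B t else C (t - i + j)

theorem glue_right (B C : ℤ → ℕ+) {i j t : ℤ} (h : i ≤ t) : glue B C i j t = C (t - i + j) :=
  if_neg (not_lt.2 h)

theorem glue_left {B C : ℤ → ℕ+} {i j : ℤ} {K : ℕ} (hBC : ∀ k < K, B (i + k) = C (j + k))
    {t : ℤ} (h : t < i + K) : glue B C i j t = B t := by
  by_cases ht : t < i
  · exact if_pos ht
  · rw [glue_right B C (not_lt.1 ht)]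
    have := hBC (t - i).toNat (by omega)
    rw [Int.toNat_of_nonneg (by omega), add_sub_cancel] at this
    rw [this, add_comm]

section
variable {d : ℕ → ℕ+} {N K : ℕ}

theorem hasWindow_of_eq {B C : ℤ → ℕ+} {i j : ℤ} (h : ∀ k < K, B (i + k) = C (j + k))
    (hC : HasWindow d N K C j) : HasWindow d N K B i := by
  obtain ⟨n, hn, hk⟩ := hC
  exact ⟨n, hn, fun k hk' => (h k hk').trans (hk k hk')⟩

theorem shift_mem_windowShift {B : ℤ → ℕ+} (h : B ∈ windowShift d N K) (s : ℤ) :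
    (fun t => B (t + s)) ∈ windowShift d N K :=
  fun i => hasWindow_of_eq (fun _ _ => congrArg B (add_right_comm _ _ _)) (h (i + s))

/-- The overlap has the full length `K`, so each window of the glued sequence lies entirely in `B`
or entirely in `C`. -/
theorem glue_mem_windowShift {B C : ℤ → ℕ+} {i j : ℤ} (hBC : ∀ k < K, B (i + k) = C (j + k))
    (hB : ∀ t ≤ i, HasWindow d N K B t) (hC : ∀ t ≥ j, HasWindow d N K C t) :
    glue B C i j ∈ windowShift d N K := by
  intro t
  rcases le_total t i with ht | ht
  · exact hasWindow_of_eq (fun k hk => glue_left hBC (by omega)) (hB t ht)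
  · refine hasWindow_of_eq (fun k hk => ?_) (hC (t - i + j) (by omega))
    rw [glue_right B C (by omega)]
    congr 1
    ring

/-- The block on `[s, s + T)` can be closed into a loop because the window at `s` returns at `s +
T`: even a window crossing the seam can be read in `Q`. -/
theorem exists_periodic_mem_windowShift {Q : ℤ → ℕ+} {s : ℤ} {T : ℕ} (hT : 0 < T) (hKT : K ≤ T)
    (hQ : ∀ k < K, Q (s + T + k) = Q (s + k)) (hw : ∀ t ≥ s, HasWindow d N K Q t) :
    ∃ P ∈ windowShift d N K, Function.Periodic P (T : ℤ) ∧
      ∀ t, s ≤ t → t < s + T + K → P t = Q t := by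
  have hT' : (0 : ℤ) < T := by exact_mod_cast hT
  set P : ℤ → ℕ+ := fun t => Q (s + (t - s) % T) with hP
  have hper : Function.Periodic P (T : ℤ) := fun t => by
    simp only [hP]
    rw [show t + T - s = t - s + T by ring, Int.add_emod_right]
  have heq : ∀ t, s ≤ t → t < s + T + K → P t = Q t := by
    intro t h1 h2
    rcases lt_or_ge t (s + T) with h | h
    · simp only [hP]
      rw [Int.emod_eq_of_lt (by omega) (by omega), add_sub_cancel]
    · have := hQ (t - s - T).toNat (by omega)
      rw [Int.toNat_of_nonneg (by omega), show s + T + (t - s - T) = t by ring] at this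
      rw [this, ← hper.sub_eq t]
      simp only [hP]
      rw [Int.emod_eq_of_lt (by omega) (by omega)]
      congr 1
      ring
  refine ⟨P, fun t => ?_, hper, heq⟩
  have h0 := Int.emod_nonneg (t - s) hT'.ne'
  have h1 := Int.emod_lt_of_pos (t - s) hT'
  refine hasWindow_of_eq (fun k hk => ?_) (hw (s + (t - s) % T) (by omega))
  rw [← heq _ (by omega) (by omega), ← hper.int_mul ((t - s) / T) (s + (t - s) % T + k)]
  congr 1
  have := Int.emod_add_mul_ediv (t - s) T
  simp only [Int.cast_id]
  linarith

/-- The tail of `d` extends to a two-sided sequence with the same windows. -/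
theorem exists_extension (hd : WindowsRecur d N K) :
    ∃ D ∈ windowShift d N K, ∀ n ≥ N, D n = d n := by
  set Q : ℤ → ℕ+ := fun t => d t.toNat with hQ
  have hw : ∀ t ≥ (N : ℤ), HasWindow d N K Q t := fun t ht =>
    ⟨t.toNat, by omega, fun k _ => congrArg d (by omega)⟩
  -- A return of the window at `N`, at distance at least `K`, gives a loop; repeated to the left, it
  -- supplies the missing past.
  obtain ⟨n', hn', he⟩ := hd N le_rfl (N + K + 1)
  obtain ⟨P, hP, -, hPQ⟩ := exists_periodic_mem_windowShift (Q := Q) (s := N) (T := n' - N)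
    (by omega) (by omega) (fun k hk => by
      have := he k hk
      simp only [hQ]
      rw [show ((N : ℤ) + (n' - N : ℕ) + k).toNat = n' + k by omega, this]
      congr 1) hw
  have hag : ∀ k < K, P ((N : ℤ) + k) = Q ((N : ℤ) + k) := fun k hk =>
    hPQ _ (by omega) (by omega)
  refine ⟨_, glue_mem_windowShift hag (fun t _ => hP t) hw, fun n hn => ?_⟩
  rw [glue_right _ _ (by omega), sub_add_cancel]
  rfl

theorem exists_window_eq (hd : WindowsRecur d N K) {B D : ℤ → ℕ+} {t : ℤ}
    (hD : ∀ n ≥ N, D n = d n) (hB : HasWindow d N K B t) (m : ℤ) :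
    ∃ t' ≥ m, ∀ k < K, B (t + k) = D (t' + k) := by
  obtain ⟨n, hn, h⟩ := hB
  obtain ⟨n', hn', h'⟩ := hd n hn (max N m.toNat)
  have := le_max_left N m.toNat
  have := le_max_right N m.toNat
  refine ⟨n', by omega, fun k hk => ?_⟩
  rw [h k hk, ← h' k hk, ← hD (n' + k) (by omega)]
  push_cast
  rfl

/-- Periodic sequences are dense in the window shift. -/
theorem exists_periodic_approx (hd : WindowsRecur d N K) {B : ℤ → ℕ+}
    (hB : B ∈ windowShift d N K) (i : ℤ) (M : ℕ) :
    ∃ P ∈ windowShift d N K, (∃ T : ℕ, 0 < T ∧ Function.Periodic P (T : ℤ)) ∧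
      ∀ t, i - M ≤ t → t < i + M → P t = B t := by
  obtain ⟨D, hDm, hD⟩ := exists_extension hd
  -- Leave `B` at `i + M` for a copy of its window in `D` at `t1`, follow `D` until the window of
  -- `B` at `i - M` appears at `t2`, and close up; the loop has length `t2 - t1 + 2 * M`.
  obtain ⟨t1, -, h1⟩ := exists_window_eq hd hD (hB (i + M)) 0
  obtain ⟨t2, ht2, h2⟩ := exists_window_eq hd hD (hB (i - M)) (t1 + K + 1)
  have hQ := glue_mem_windowShift h1 (fun t _ => hB t) (fun t _ => hDm t)
  obtain ⟨P, hP, hper, hPQ⟩ := exists_periodic_mem_windowShift (Q := glue B D (i + M) t1)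
    (s := i - M) (T := (t2 - t1 + 2 * M).toNat) (K := K) (by omega) (by omega) (fun k hk => by
      rw [glue_right _ _ (by omega), glue_left h1 (by omega), h2 k hk]
      congr 1
      omega) (fun t _ => hQ t)
  refine ⟨P, hP, ⟨_, by omega, hper⟩, fun t h3 h4 => ?_⟩
  rw [hPQ t h3 (by omega), glue_left h1 (by omega)]

theorem biLambda_le_of_forall_periodic (hd : WindowsRecur d N K) {a : ℝ}
    (h : ∀ P ∈ windowShift d N K, ∀ T : ℕ, 0 < T → Function.Periodic P (T : ℤ) →
      ∀ i, biLambda P i ≤ a) {B : ℤ → ℕ+} (hB : B ∈ windowShift d N K) (i : ℤ) :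
    biLambda B i ≤ a := by
  have hlim : Tendsto (fun m : ℕ => a + 2 * (1 / 4 : ℝ) ^ m) atTop (𝓝 a) := by
    simpa using ((tendsto_pow_atTop_nhds_zero_of_lt_one (by norm_num : (0 : ℝ) ≤ 1 / 4)
      (by norm_num)).const_mul 2).const_add a
  refine ge_of_tendsto' hlim fun m => ?_
  obtain ⟨P, hP, ⟨T, hT, hper⟩, he⟩ := exists_periodic_approx hd hB i (2 * m + 2)
  have h1 := abs_le.1 (abs_biLambda_sub_biLambda_le (B := B) (C := P) (i := i) (j := i) (m := m)
    fun k hk hk' => (he (i + k) (by push_cast; omega) (by push_cast; omega)).symm)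
  linarith [h P hP T hT hper i, h1.2]

theorem continuous_cfFull : Continuous cfFull := by
  refine continuous_iff_continuousAt.2 fun d => Metric.tendsto_nhds.2 fun ε hε => ?_
  obtain ⟨m, hm⟩ := exists_pow_lt_of_lt_one hε (by norm_num : (1 / 4 : ℝ) < 1)
  have : ∀ᶠ d' in 𝓝 d, ∀ k ∈ Set.Iic (2 * m), d' k = d k := by
    rw [eventually_all_finite (Set.finite_Iic _)]
    exact fun k _ => (continuous_apply (A := fun _ : ℕ => ℕ+) k).continuousAt.eventually
      (show ∀ᶠ x in 𝓝 (d k), x = d k from (isOpen_discrete {d k}).mem_nhds rfl)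
  filter_upwards [this] with d' hd'
  exact (abs_cfFull_sub_le hd').trans_lt hm

theorem isCompact_windowShift (hK : 0 < K) {C : ℕ+} (hC : ∀ n, d n ≤ C) :
    IsCompact (windowShift d N K) := by
  refine (isCompact_univ_pi fun _ : ℤ => (Set.finite_Iic C).isCompact).of_isClosed_subset ?_ ?_
  · have : windowShift d N K = ⋂ i : ℤ, (fun (B : ℤ → ℕ+) (k : Fin K) => B (i + k)) ⁻¹'
        {w | ∃ n ≥ N, ∀ k : Fin K, w k = d (n + k)} := by
      ext B
      simp only [windowShift, HasWindow, Set.mem_iInter, Set.mem_preimage, Set.mem_ofPred_eq,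
        Fin.forall_iff]
    rw [this]
    exact isClosed_iInter fun i => (isClosed_discrete _).preimage
      (continuous_pi fun k => continuous_apply _)
  · intro B hB i _
    obtain ⟨n, -, h⟩ := hB i
    have := h 0 hK
    rw [Nat.cast_zero, add_zero] at this
    rw [this]
    exact hC _

end

/-! ### Attainable numbers at the left end of a gap -/

/-- If `B` has the largest past among all sequences in the window shift with a fixed central
window, and the finite pasts of `d` at `n < n'` with the same window are at least as large, then
the past of `B` is periodic with period `n' - n`. -/
theorem past_periodic_of_isMax {d : ℕ → ℕ+} {N M : ℕ} {B D : ℤ → ℕ+}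
    (hD : D ∈ windowShift d N (2 * M + 1)) (hDd : ∀ n ≥ N, D n = d n)
    (hB : B ∈ windowShift d N (2 * M + 1))
    (hmax : ∀ C ∈ windowShift d N (2 * M + 1),
      (∀ t : ℤ, -M ≤ t → t ≤ M → C t = B t) →
        (cfFull fun k : ℕ => C (-k)) ≤ cfFull fun k : ℕ => B (-k))
    {n L : ℕ} (hL : 0 < L) (hn : N + M + 2 ≤ n)
    (hw : ∀ t : ℤ, -M ≤ t → t ≤ M → D (n + t) = B t)
    (hw' : ∀ t : ℤ, -M ≤ t → t ≤ M → D ((n + L : ℕ) + t) = B t)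
    (hle : (cfFull fun k : ℕ => B (-k)) ≤ cfBack d n)
    (hle' : (cfFull fun k : ℕ => B (-k)) ≤ cfBack d (n + L)) :
    (∀ k < L, B (-k) = d (n + L - k)) ∧ ∀ k : ℕ, B (-(L + k : ℕ)) = B (-k) := by
  set Y := cfFull fun k : ℕ => B (-k) with hY
  have hY1 : 1 < Y := one_lt_cfFull _
  have hag : ∀ k < 2 * M + 1, B ((-M : ℤ) + k) = D ((n - M : ℤ) + k) := fun k hk => by
    rw [← hw _ (by omega) (by omega)]
    congr 1
    ring
  set C := glue B D (-M) (n - M) with hC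
  have hCm : C ∈ windowShift d N (2 * M + 1) :=
    glue_mem_windowShift hag (fun t _ => hB t) (fun t _ => hD t)
  have hCD : ∀ t : ℤ, -M ≤ t → C t = D (n + t) := fun t ht => by
    rw [hC, glue_right _ _ ht]
    congr 1
    ring
  have hCB : ∀ t : ℤ, t ≤ M → C t = B t := fun t ht => glue_left hag (by push_cast; omega)
  -- the word between `n` and `n + L` maps the maximal past to a past, hence below the maximum
  have h1 : cfFin (fun k => d (n + L - k)) L Y ≤ Y := by
    have := hmax _ (shift_mem_windowShift hCm L) fun t ht1 ht2 => by
      rw [hCD _ (by omega), ← hw' t ht1 ht2]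
      congr 1
      push_cast
      ring
    rw [cfFull_eq_cfFin _ L] at this
    have e1 : ∀ k : ℕ, C (-(L + k : ℕ) + L) = B (-k) := fun k => by
      rw [← hCB _ (by omega)]
      congr 1
      push_cast
      ring
    simp only [e1] at this
    rwa [cfFin_congr (e' := fun k => d (n + L - k)) (fun k hk => by
      rw [hCD _ (by omega), ← hDd _ (by omega)]
      congr 1
      omega)] at this
  rw [cfBack_add] at hle'
  -- Prepending the word sends `Y` to at most `Y` and `cfBack d n` to at least `Y`, so `Y` has a
  -- preimage `Z` in between. Digit uniqueness makes `Z` the past of `B` at `-L`.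
  obtain ⟨Z, hZ, hZY⟩ := exists_cfFin_eq (fun k => d (n + L - k)) L (one_pos.trans hY1)
    (one_pos.trans_le (one_le_cfBack d n)) (Set.mem_uIcc_of_le h1 hle')
  have hYZ : Y ≤ Z := by
    rw [Set.uIcc_of_le hle] at hZ
    exact hZ.1
  obtain ⟨hdig, htail⟩ := digits_of_cfFull_eq_cfFin (hY1.trans_le hYZ) hZY.symm
  -- the remaining past has the same central window
  have hback : cfBack d n = cfFin (fun k : ℕ => B (-k)) (M + 1) (cfBack d (n - M - 1)) := by
    have := cfBack_add d (n - M - 1) (M + 1)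
    rw [show n - M - 1 + (M + 1) = n by omega] at this
    rw [this]
    refine cfFin_congr (fun k hk => ?_) _
    rw [← hw _ (by omega) (by omega), ← hDd _ (by omega)]
    congr 1
    omega
  have hZ' := hZ
  rw [hback, hY, cfFull_eq_cfFin _ (M + 1)] at hZ'
  -- The bound `N + M + 2 ≤ n` leaves at least two digits, hence the strict inequality that digit
  -- uniqueness requires.
  have hb1 : 1 < cfBack d (n - M - 1) := by
    rw [show n - M - 1 = n - M - 2 + 1 by omega]
    exact one_lt_cfBack_succ _ _
  obtain ⟨r, hr, hrZ⟩ := exists_cfFin_eq _ _ (cfFull_pos _) (one_pos.trans hb1) hZ'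
  have hr1 : 1 < r := lt_of_lt_of_le (lt_min (one_lt_cfFull _) hb1) hr.1
  obtain ⟨hdig', -⟩ := digits_of_cfFull_eq_cfFin hr1 (htail.trans hrZ.symm)
  -- Maximality applies to `B` seen from `-L`, giving `Z ≤ Y` and so `Z = Y`. The central window
  -- agrees: for `t ≤ 0` by the digits of `Z`, for `0 < t < L` by the word, for `t ≥ L` by comparing
  -- the windows of `D` at `n` and `n + L`.
  have hZle := hmax _ (shift_mem_windowShift hB (-L)) fun t ht1 ht2 => by
    rcases le_or_gt t 0 with h | h
    · have := hdig' t.natAbs (by omega)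
      rw [show -((t.natAbs : ℕ) : ℤ) = t by omega] at this
      rw [← this]
      congr 1
      omega
    · rcases lt_or_ge t L with h' | h'
      · have := hdig (L - t.toNat) (by omega)
        rw [← hw t ht1 ht2, show (n : ℤ) + t = (n + t.toNat : ℕ) by omega,
          hDd _ (by omega), show n + t.toNat = n + L - (L - t.toNat) by omega, ← this]
        congr 1
        omega
      · rw [← hw t ht1 ht2, ← hw' (t + -L) (by omega) (by omega)]
        congr 1
        push_cast
        ring
  have e2 : (fun k : ℕ => B (-(k : ℤ) + -(L : ℤ))) = fun k : ℕ => B (-(L + k : ℕ)) := by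
    funext k
    congr 1
    push_cast
    ring
  simp only [e2] at hZle
  refine ⟨hdig, fun k => ?_⟩
  exact congrFun (cfFull_injective (le_antisymm hZle (htail ▸ hYZ))) k

/-- A one-sided sequence with infinitely many pasts of this kind is eventually periodic. -/
theorem exists_periodic_of_past {d : ℕ → ℕ+} {B : ℤ → ℕ+} {S : Set ℕ} (hS : S.Infinite)
    (h : ∀ n ∈ S, ∀ L : ℕ, 0 < L → n + L ∈ S →
      (∀ k < L, B (-k) = d (n + L - k)) ∧ ∀ k : ℕ, B (-(L + k : ℕ)) = B (-k)) :
    ∃ P : ℤ → ℕ+, IsPurelyPeriodic P ∧ ∃ n ∈ S, (∀ s : ℕ, 0 < s → d (n + s) = P s) ∧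
      ∀ L : ℕ, 0 < L → n + L ∈ S → Function.Periodic P (L : ℤ) := by
  obtain ⟨n, hn⟩ := hS.nonempty
  have big : ∀ m, ∃ L, m < L ∧ n + L ∈ S := fun m => by
    obtain ⟨n', hn', hlt⟩ := hS.exists_gt (n + m)
    exact ⟨n' - n, by omega, by rwa [show n + (n' - n) = n' by omega]⟩
  obtain ⟨T, hT, hTS⟩ := big 0
  have hT' : (0 : ℤ) < T := by exact_mod_cast hT
  have hBT : ∀ j k : ℕ, B (-(T * j + k : ℕ)) = B (-k) := fun j k => by
    induction j with
    | zero => simp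
    | succ j ih =>
      rw [← ih, ← (h n hn T hT hTS).2 (T * j + k)]
      congr 3
      ring
  -- Only indices `≤ 0` of `B` are used, where its periodicity is known.
  set P : ℤ → ℕ+ := fun t => B (-((-t) % T)) with hP
  have hper : Function.Periodic P (T : ℤ) := fun t => by
    simp only [hP]
    rw [neg_add, ← sub_eq_add_neg, Int.sub_emod_right]
  have hPB : ∀ k : ℕ, P (-k) = B (-k) := fun k => by
    simp only [hP, neg_neg]
    have := hBT (k / T) (k % T)
    rw [Nat.div_add_mod] at this
    rw [this, Int.natCast_mod]
  have hperL : ∀ L : ℕ, 0 < L → n + L ∈ S → Function.Periodic P (L : ℤ) := fun L hL hLS t => by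
    have hm : 0 ≤ (|t| + L) * T - (t + L) := by
      have := le_abs_self t
      have := abs_nonneg t
      nlinarith
    obtain ⟨k, hk⟩ := Int.eq_ofNat_of_zero_le hm
    rw [← hper.int_mul (-(|t| + L)) (t + L), ← hper.int_mul (-(|t| + L)) t]
    have := (h n hn L hL hLS).2 k
    rw [← hPB, ← hPB] at this
    simp only [Int.cast_id]
    rw [show t + L + -(|t| + L) * T = -(k : ℤ) by linarith,
      show t + -(|t| + L) * T = -((L + k : ℕ) : ℤ) by
        push_cast
        linarith]
    exact this.symm
  refine ⟨P, ⟨T, hT, hper⟩, n, hn, fun s hs => ?_, hperL⟩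
  -- A return time `L > s` puts `n + s` inside a known word, and `L` is itself a period of `P`.
  obtain ⟨L, hL, hLS⟩ := big s
  have h1 := (h n hn L (by omega) hLS).1 (L - s) (by omega)
  rw [show n + L - (L - s) = n + s by omega, ← hPB] at h1
  rw [← h1, ← hperL L (by omega) hLS]
  congr 1
  omega

theorem exists_purelyPeriodic_of_attainable {a b : ℝ} (hab : IsMaximalGap a b) {c : ℤ}
    {d : ℕ → ℕ+} (h : lagrangeConst (c + (cfFull d)⁻¹) = (a : EReal))
    (hinf : {n | a ≤ oneLambda d n}.Infinite) :
    ∃ B : ℤ → ℕ+, IsPurelyPeriodic B ∧ biLambda B 0 = a ∧ markoffM B = (a : EReal) := by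
  have hlt := hab.1
  obtain ⟨C, hC⟩ : ∃ C : ℕ+, ∀ n, d n ≤ C := by
    obtain ⟨n0, hn0⟩ := eventually_atTop.1 (eventually_oneLambda_lt h hlt)
    obtain ⟨C1, hC1⟩ := ((Set.finite_lt_nat n0).image d).bddAbove
    obtain ⟨C2, hC2⟩ := exists_nat_ge b
    refine ⟨C1 + ⟨C2 + 1, by omega⟩, fun n => ?_⟩
    rcases lt_or_ge n n0 with hn | hn
    · exact (hC1 ⟨n, hn, rfl⟩).trans (PNat.lt_add_right _ _).le
    · refine le_trans ?_ (PNat.lt_add_left _ _).le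
      have h1 := hn0 n hn
      have h2 := coe_le_cfBack d n
      have h3 := inv_pos.2 (cfFull_pos fun k => d (n + 1 + k))
      rw [oneLambda] at h1
      have h4 : ((d n : ℕ) : ℝ) ≤ (C2 + 1 : ℕ) := by push_cast; linarith
      have h5 : (d n : ℕ) ≤ C2 + 1 := by exact_mod_cast h4
      exact h5
  obtain ⟨m, hm⟩ : ∃ m : ℕ, 2 * (1 / 4 : ℝ) ^ m < (b - a) / 2 := by
    obtain ⟨m, hm⟩ := exists_pow_lt_of_lt_one (show 0 < (b - a) / 4 by linarith)
      (by norm_num : (1 / 4 : ℝ) < 1)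
    exact ⟨m, by linarith⟩
  -- A window of radius `M` contains the offsets from `-2 * m` to `2 * m + 1` that fix `λ` up to an
  -- error below `(b - a) / 2`; with `λ_n < (a + b) / 2` this keeps `Ω` below `b`.
  set M := 2 * m + 1 with hM
  obtain ⟨N, hN1, hN2⟩ := ((eventually_windowsRecur hC (2 * M + 1)).and
    (eventually_forall_ge_atTop.2
      (eventually_oneLambda_lt h (show a < (a + b) / 2 by linarith)))).exists
  set Ω := windowShift d N (2 * M + 1) with hΩ
  have hΩb : ∀ P ∈ Ω, ∀ i, biLambda P i < b := fun P hP i => by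
    obtain ⟨n, hn, hk⟩ := hP (i - M)
    have h1 := hN2 (n + M) (by omega)
    have h2 := abs_oneLambda_sub_biLambda_le (d := d) (B := P) (i := i) (m := m) (n := n + M)
      (by omega) fun k hk1 hk2 => by
        have := hk (k + M).toNat (by omega)
        rw [show i - M + (k + M).toNat = i + k by omega] at this
        rw [this]
        congr 1
        omega
    have := (abs_le.1 h2).1
    linarith
  -- The gap pushes the bound from `b` down to `a` on periodic members, and density extends it to
  -- `Ω`.
  have hΩa : ∀ P ∈ Ω, ∀ i, biLambda P i ≤ a := fun P hP i =>
    biLambda_le_of_forall_periodic hN1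
      (fun P hP T hT hper i => biLambda_le_of_periodic hab hT hper (hΩb P hP) i) hP i
  obtain ⟨D, hD, hDd⟩ := exists_extension hN1
  -- infinitely many good positions with a common window
  obtain ⟨w, hw⟩ : ∃ w : Fin (2 * M + 1) → ℕ+, {n | N + M + 2 ≤ n ∧ a ≤ oneLambda d n ∧
      (fun k : Fin (2 * M + 1) => d (n - M + k)) = w}.Infinite := by
    by_contra! hcon
    refine (hinf.sdiff (Set.finite_lt_nat (N + M + 2))) ?_
    refine Set.Finite.of_finite_fibers (fun n (k : Fin (2 * M + 1)) => d (n - M + k)) ?_ ?_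
    · refine (finite_range_window hC (2 * M + 1)).subset ?_
      rintro _ ⟨n, -, rfl⟩
      exact ⟨n - M, rfl⟩
    · intro w _
      refine (hcon w).subset ?_
      rintro n ⟨⟨hn1, hn2⟩, hn3⟩
      exact ⟨not_lt.1 hn2, hn1, hn3⟩
  set S := {n | N + M + 2 ≤ n ∧ a ≤ oneLambda d n ∧
      (fun k : Fin (2 * M + 1) => d (n - M + k)) = w} with hS
  obtain ⟨n₀, hn₀⟩ := hw.nonempty
  have hwin : ∀ n ∈ S, ∀ t : ℤ, -M ≤ t → t ≤ M → D (n + t) = D (n₀ + t) := by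
    intro n hn t ht1 ht2
    have h1 := congrFun (hn.2.2.trans hn₀.2.2.symm) ⟨(t + M).toNat, by omega⟩
    have e : ∀ n ∈ S, D (n + t) = d (n - M + (t + M).toNat) := fun n hn => by
      have := hn.1
      rw [← hDd _ (by omega)]
      congr 1
      omega
    rw [e n hn, e n₀ hn₀]
    exact h1
  -- a sequence with this window and maximal past
  obtain ⟨B, ⟨hB, hBw⟩, hBmax⟩ := IsCompact.exists_isMaxOn
    (s := Ω ∩ {B | ∀ t : ℤ, -M ≤ t → t ≤ M → B t = D (n₀ + t)})
    (f := fun B => cfFull fun k : ℕ => B (-k))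
    ((isCompact_windowShift (by omega) hC).inter_right (by
      simp only [Set.ofPred_forall]
      exact isClosed_iInter fun t => isClosed_iInter fun _ => isClosed_iInter fun _ =>
        isClosed_eq (continuous_apply t) continuous_const))
    ⟨_, shift_mem_windowShift hD n₀, fun t _ _ => congrArg D (add_comm _ _)⟩
    (continuous_cfFull.comp (continuous_pi fun k : ℕ =>
      continuous_apply (A := fun _ : ℤ => ℕ+) (-(k : ℤ)))).continuousOn
  have hSB : ∀ n ∈ S, ∀ t : ℤ, -M ≤ t → t ≤ M → D (n + t) = B t := fun n hn t h1 h2 =>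
    (hwin n hn t h1 h2).trans (hBw t h1 h2).symm
  -- The glued sequence has the past of `B` and the future of `d` at `n`; equal futures cancel
  -- between `λ_0 ≤ a` and `a ≤ λ_n`.
  have hle : ∀ n ∈ S, (cfFull fun k : ℕ => B (-k)) ≤ cfBack d n := fun n hn => by
    have hag : ∀ k < 2 * M + 1, B ((-M : ℤ) + k) = D ((n - M : ℤ) + k) := fun k hk => by
      rw [← hSB n hn _ (by omega) (by omega)]
      congr 1
      ring
    have h1 := hΩa _ (glue_mem_windowShift hag (fun t _ => hB t) (fun t _ => hD t)) 0
    have h2 := hn.2.1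
    have h3 := hn.1
    rw [biLambda_eq] at h1
    have e1 : ∀ k : ℕ, glue B D (-M) (n - M) (0 - k) = B (-k) := fun k => by
      rw [glue_left hag (by omega), zero_sub]
    have e2 : ∀ k : ℕ, glue B D (-M) (n - M) (0 + 1 + k) = d (n + 1 + k) := fun k => by
      rw [glue_right _ _ (by omega), ← hDd _ (by omega)]
      congr 1
      push_cast
      ring
    simp only [e1, e2] at h1
    rw [oneLambda] at h2
    linarith
  obtain ⟨P, hP, n, hn, hPd, hPL⟩ := exists_periodic_of_past hw fun n hn L hL hnL =>
    past_periodic_of_isMax hD hDd hB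
      (fun C hC hCB => hBmax ⟨hC, fun t h1 h2 => (hCB t h1 h2).trans (hBw t h1 h2)⟩)
      hL hn.1 (hSB n hn) (hSB _ hnL) (hle n hn) (hle _ hnL)
  have hPd' : ∀ t : ℤ, 0 < t → d (n + t).toNat = P t := fun t ht => by
    rw [show ((n : ℤ) + t).toNat = n + t.toNat by omega, hPd _ (by omega)]
    congr 1
    omega
  have hnN := hn.1
  have hPΩ : P ∈ Ω := fun t => by
    obtain ⟨T, hT, hper⟩ := hP
    have hbig : 0 < t + (|t| + 1) * T := by
      have := neg_abs_le t
      have := abs_nonneg t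
      have : (1 : ℤ) ≤ T := by exact_mod_cast hT
      nlinarith
    refine ⟨(n + (t + (|t| + 1) * T)).toNat, by omega, fun k _ => ?_⟩
    rw [← hper.int_mul (|t| + 1), Int.cast_id, add_right_comm, ← hPd' _ (by omega)]
    congr 1
    omega
  have h0 : biLambda P 0 = a := by
    refine le_antisymm (hΩa P hPΩ 0) ?_
    have hlim : Tendsto (fun m : ℕ => biLambda P 0 + 2 * (1 / 4 : ℝ) ^ m) atTop
        (𝓝 (biLambda P 0)) := by
      simpa using ((tendsto_pow_atTop_nhds_zero_of_lt_one (by norm_num : (0 : ℝ) ≤ 1 / 4)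
        (by norm_num)).const_mul 2).const_add (biLambda P 0)
    refine ge_of_tendsto' hlim fun m => ?_
    -- So far out the whole window around `n'` lies beyond `n`, where `d` follows `P`; and `n' - n`
    -- is a period of `P`, so the window is that of `P` at `0`.
    obtain ⟨n', hn', hgt⟩ := hw.exists_gt (n + 2 * m)
    have h1 := abs_oneLambda_sub_biLambda_le (d := d) (B := P) (i := 0) (m := m) (n := n')
      (by omega) fun k hk _ => by
        have h2 := hPL (n' - n) (by omega) (by rwa [show n + (n' - n) = n' by omega])
        rw [zero_add, ← h2, ← hPd' _ (by omega)]
        congr 1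
        omega
    have h3 : a ≤ oneLambda d n' := hn'.2.1
    linarith [(abs_le.1 h1).2]
  refine ⟨P, hP, h0, le_antisymm (iSup_le fun i => EReal.coe_le_coe_iff.2 (hΩa P hPΩ i)) ?_⟩
  rw [← h0]
  exact le_iSup (fun i => (biLambda P i : EReal)) 0

theorem corollary1 (a b : ℝ) (hab : IsMaximalGap a b) :
    ¬ IsAdmissible a ↔
      ¬ ∃ B : ℤ → ℕ+, IsPurelyPeriodic B ∧ biLambda B 0 = a ∧ markoffM B = (a : EReal) := by
  refine not_congr ⟨fun ⟨_, α, hα, hatt, hL⟩ => ?_, fun ⟨B, hB, h0, hM⟩ =>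
    isAdmissible_of_periodic hab.2.1 hB h0 hM⟩
  obtain ⟨c, d, rfl⟩ := exists_eq_add_inv_cfFull hα
  exact exists_purelyPeriodic_of_attainable hab hL ((isAttainable_iff hL).1 hatt)
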